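/- **Setting.** Let $\mathcal X$ be a set (the data space) and let $\rho:\mathcal X\times\mathbb R^p\to\mathbb R$ be a loss, $p\ge 1$, such that $\rho(x,\cdot)$ is twice differentiable for every $x\in\mathcal X$. Put $\Psi(x,\theta)=\nabla_\theta\rho(x,\theta)$, $\dot\Psi(x,\theta)=\nabla^2_\theta\rho(x,\theta)$, and, for a data set $x=(x_1,\dots,x_n)\in\mathcal X^n$, $n\ge1$, let $\mathcal L_n(\theta)=\frac1n\sum_{i=1}^n\rho(x_i,\theta)$. Let $B,\bar B>0$ be such that $\|\Psi(x,\theta)\|_2\le B$ for all $x,\theta$, and suppose that there is a map $a:\mathcal X\times\mathbb R^p\to\mathbb R^p$ with $\sup_{x,\theta}\|a(x,\theta)\|_2^2\le\bar B$ and, for every data set in $\mathcal X^n$ and every $\theta$, $\nabla^2\mathcal L_n(\theta)=\frac1n\sum_{i=1}^n a(x_i,\theta)a(x_i,\theta)^\top$. **Algorithm.** Fix $K\ge1$, $\mu>0$ and $\theta^{(0)}\in\mathbb R^p$ (not depending on the data). For $0\le k<K$ let $$\theta^{(k+1)}=\theta^{(k)}-H_k^{-1}\Big(\frac1n\sum_{i=1}^n\Psi(x_i,\theta^{(k)})+\frac{2B\sqrt{2K}}{\mu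 n}Z_k\Big),\qquad H_k=\frac1n\sum_{i=1}^n\dot\Psi(x_i,\theta^{(k)})+\frac{2\bar B\sqrt{2K}}{\mu n}W_k,$$ where the $Z_k$ are standard Gaussian vectors in $\mathbb R^p$, the $W_k$ are symmetric random $p\times p$ matrices whose upper-triangular entries, including the diagonal, are standard normal, and all these scalar variables are independent. ($H_k$ is invertible almost surely; where it is not, read $H_k^{-1}$ as $0$.) **Privacy.** A random function $h$ of the data set is $\mu$-GDP if, for any two data sets in $\mathcal X^n$ that differ in exactly one entry and any $\alpha\in[0,1]$, every (possibly randomized) level-$\alpha$ test of one data set against the other, based on the output of $h$, has power at most $1-\Phi(\Phi^{-1}(1-\alpha)-\mu)$, where $\Phi$ is the standard normal distribution function. **Theorem.** (i) $\theta^{(K)}$ is $\mu$-GDP. (ii) Let $L,\tau_1,\tau_2,r>0$ and $0<\xi<1$, and let the data set $x\in\mathcal X^n$ and $\theta_0,\hat\theta\in\mathbb R^p$ satisfy, with $\mathcal B_s(\theta)$ the closed Euclidean ball: - $\hat\theta$ minimizes $\mathcal L_n$ over $\mathbb R^p$, and $\hat\theta\in\mathcal B_{r/2}(\theta_0)$;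 - $\mathcal L_n(\theta_1)-\mathcal L_n(\theta_2)\ge\langle\nabla\mathcal L_n(\theta_2),\theta_1-\theta_2\rangle+\tau_1\|\theta_1-\theta_2\|_2^2$ for all $\theta_1,\theta_2\in\mathcal B_r(\theta_0)$; - $\mathcal L_n(\theta_1)-\mathcal L_n(\theta_2)\le\langle\nabla\mathcal L_n(\theta_2),\theta_1-\theta_2\rangle+\tau_2\|\theta_1-\theta_2\|_2^2$ for all $\theta_1,\theta_2\in\mathbb R^p$; - $\nabla^2\mathcal L_n(\theta)$ is positive definite for all $\theta\in\mathcal B_r(\theta_0)$; - $\|\nabla^2\mathcal L_n(\theta_1)-\nabla^2\mathcal L_n(\theta_2)\|_2\le L\|\theta_1-\theta_2\|_2$ for all $\theta_1,\theta_2\in\mathbb R^p$, in the spectral norm; - $\|\nabla\mathcal L_n(\theta^{(0)})\|_2\le\min\{\tau_1 r,\ \tau_1^2/L\}$. Suppose that $\mu\le\mu_{\max}$ and $$n\ \ge\ c_1\,\frac{\sqrt{Kp\log(Kp/\xi)}}{\mu},\qquad K\ \ge\ c_2\,\max\{1,\log\log n\}$$ (with the maximum read as $1$ for $n=1$). Then,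 with probability at least $1-\xi$, $$\|\theta^{(K)}-\hat\theta\|_2\ \le\ C\,\frac{\sqrt{Kp\log(Kp/\xi)}}{\mu n}.$$ Here $C>0$ depends only on $L,\tau_1,B,\bar B$; $c_1>0$ depends only on these and on $r,\tau_2$; and $c_2>0$ depends only on all of these and on the upper bound $\mu_{\max}>0$ for the privacy level (an arbitrary positive number). -/

import Mathlib

namespace NoisyNewton

/-! ### Gaussian differential privacy -/

/-- The standard normal cumulative distribution function `Φ`. -/
noncomputable def stdNormalCDF (t : ℝ) : ℝ :=
  ProbabilityTheory.cdf (ProbabilityTheory.gaussianReal 0 1) t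

/-- The standard normal quantile function `Φ⁻¹`, meaningful for `0 < u < 1`. -/
noncomputable def stdNormalQuantile (u : ℝ) : ℝ :=
  sInf {t : ℝ | u ≤ stdNormalCDF t}

/-- The Gaussian trade-off function `α ↦ Φ(Φ⁻¹(1 - α) - μ)`, with the usual conventions
`Φ(+∞) = 1` at `α = 0` and `Φ(-∞) = 0` at `α = 1`. -/
noncomputable def gaussianTradeoff (μ α : ℝ) : ℝ :=
  if α ≤ 0 then 1
  else if 1 ≤ α then 0
  else stdNormalCDF (stdNormalQuantile (1 - α) - μ)

/-- Two data sets of size `n` are neighbours if they differ in exactly one entry, i.e. if their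
Hamming distance is `1`. -/
def Neighbours {𝓧 : Type*} {n : ℕ} (x x' : Fin n → 𝓧) : Prop :=
  Set.ncard {i | x i ≠ x' i} = 1

/-- A random function `h` of the data is `f`-DP: for every pair of neighbouring data sets, every
level-`α` (possibly randomized) test of the one against the other, based on the output of `h`, has
power at most `1 - f α`. -/
def IsFDP {𝓧 Ω E : Type*} [MeasurableSpace Ω] [MeasurableSpace E] {n : ℕ}
    (f : ℝ → ℝ) (P : MeasureTheory.Measure Ω) (h : (Fin n → 𝓧) → Ω → E) : Prop :=
  (∀ x, AEMeasurable (h x) P) ∧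
    ∀ x x' : Fin n → 𝓧, Neighbours x x' →
      ∀ φ : E → ℝ, Measurable φ → (∀ e, φ e ∈ Set.Icc (0 : ℝ) 1) →
        ∀ α ∈ Set.Icc (0 : ℝ) 1,
          ∫ ω, φ (h x ω) ∂P ≤ α → ∫ ω, φ (h x' ω) ∂P ≤ 1 - f α

/-- `μ`-Gaussian differential privacy: `f`-DP for the Gaussian trade-off function. (It is the same
to ask for `f`-DP for some trade-off function `f` lying above the Gaussian one.) -/
def IsGDP {𝓧 Ω E : Type*} [MeasurableSpace Ω] [MeasurableSpace E] {n : ℕ}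
    (μ : ℝ) (P : MeasureTheory.Measure Ω) (h : (Fin n → 𝓧) → Ω → E) : Prop :=
  IsFDP (gaussianTradeoff μ) P h

/-! ### Empirical risk, score and Hessian -/

/-- The Hessian of `f`, the derivative of its gradient, as an operator on `ℝᵖ`; its operator norm
is the spectral norm. -/
noncomputable def hessian {p : ℕ} (f : EuclideanSpace ℝ (Fin p) → ℝ)
    (θ : EuclideanSpace ℝ (Fin p)) :
    EuclideanSpace ℝ (Fin p) →L[ℝ] EuclideanSpace ℝ (Fin p) :=
  fderiv ℝ (gradient f) θ

/-- The empirical risk `𝓛ₙ(θ) = n⁻¹ ∑ᵢ ρ(xᵢ, θ)`. -/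
noncomputable def empRisk {𝓧 : Type*} {p n : ℕ} (ρ : 𝓧 → EuclideanSpace ℝ (Fin p) → ℝ)
    (x : Fin n → 𝓧) (θ : EuclideanSpace ℝ (Fin p)) : ℝ :=
  (n : ℝ)⁻¹ * ∑ i, ρ (x i) θ

/-- The score `Ψ(x, θ) = ∂ρ(x, θ)/∂θ`. -/
noncomputable def score {𝓧 : Type*} {p : ℕ} (ρ : 𝓧 → EuclideanSpace ℝ (Fin p) → ℝ)
    (x : 𝓧) (θ : EuclideanSpace ℝ (Fin p)) : EuclideanSpace ℝ (Fin p) :=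
  gradient (ρ x) θ

/-- The derivative `Ψ̇(x, θ) = ∂Ψ(x, θ)/∂θᵀ` of the score. -/
noncomputable def scoreDeriv {𝓧 : Type*} {p : ℕ} (ρ : 𝓧 → EuclideanSpace ℝ (Fin p) → ℝ)
    (x : 𝓧) (θ : EuclideanSpace ℝ (Fin p)) :
    EuclideanSpace ℝ (Fin p) →L[ℝ] EuclideanSpace ℝ (Fin p) :=
  fderiv ℝ (score ρ x) θ

/-! ### Regularity conditions -/

/-- `f` is `τ₁`-strongly convex on the ball of radius `r` about `θ₀` and `τ₂`-smooth on `ℝᵖ`. -/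
def LocallyStronglyConvexSmooth {p : ℕ} (f : EuclideanSpace ℝ (Fin p) → ℝ)
    (θ₀ : EuclideanSpace ℝ (Fin p)) (r τ₁ τ₂ : ℝ) : Prop :=
  (∀ θ₁ ∈ Metric.closedBall θ₀ r, ∀ θ₂ ∈ Metric.closedBall θ₀ r,
    inner ℝ (gradient f θ₂) (θ₁ - θ₂) + τ₁ * ‖θ₁ - θ₂‖ ^ 2 ≤ f θ₁ - f θ₂) ∧
  (∀ θ₁ θ₂ : EuclideanSpace ℝ (Fin p),
    f θ₁ - f θ₂ ≤ inner ℝ (gradient f θ₂) (θ₁ - θ₂) + τ₂ * ‖θ₁ - θ₂‖ ^ 2)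

/-- For every data set `x` of size `n` the Hessian of the empirical risk has the Gram form
`n⁻¹ ∑ᵢ a(xᵢ, θ) a(xᵢ, θ)ᵀ`, for a map `a` with `sup ‖a(x, θ)‖² ≤ Bbar`. -/
def GramHessian {𝓧 : Type*} {p : ℕ} (n : ℕ) (ρ : 𝓧 → EuclideanSpace ℝ (Fin p) → ℝ)
    (Bbar : ℝ) : Prop :=
  ∃ a : 𝓧 → EuclideanSpace ℝ (Fin p) → EuclideanSpace ℝ (Fin p),
    (∀ x θ, ‖a x θ‖ ^ 2 ≤ Bbar) ∧
    ∀ (x : Fin n → 𝓧) (θ : EuclideanSpace ℝ (Fin p)),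
      hessian (empRisk ρ x) θ =
        (n : ℝ)⁻¹ • ∑ i, InnerProductSpace.rankOne ℝ (a (x i) θ) (a (x i) θ)

/-- The Hessian of `f` is positive definite on the ball of radius `r` about `θ₀`. -/
def HessianPosDefOnBall {p : ℕ} (f : EuclideanSpace ℝ (Fin p) → ℝ)
    (θ₀ : EuclideanSpace ℝ (Fin p)) (r : ℝ) : Prop :=
  ∀ θ ∈ Metric.closedBall θ₀ r, ∀ v : EuclideanSpace ℝ (Fin p), v ≠ 0 →
    0 < inner ℝ v (hessian f θ v)

/-- The Hessian of `f` is `L`-Lipschitz on `ℝᵖ` in the spectral norm. -/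
def LipschitzHessian {p : ℕ} (f : EuclideanSpace ℝ (Fin p) → ℝ) (L : ℝ) : Prop :=
  ∀ θ₁ θ₂ : EuclideanSpace ℝ (Fin p), ‖hessian f θ₁ - hessian f θ₂‖ ≤ L * ‖θ₁ - θ₂‖

/-! ### The noisy Newton iteration -/

/-- The scalar entries of the noise of the first `K` iterations: the coordinates of the vectors
`Z k`, and the upper-triangular entries (diagonal included) of the matrices `W k`. -/
def noiseEntry {Ω : Type*} {p : ℕ} (K : ℕ) (Z : ℕ → Ω → EuclideanSpace ℝ (Fin p))
    (W : ℕ → Ω → Matrix (Fin p) (Fin p) ℝ) :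
    Fin K × (Fin p ⊕ {ij : Fin p × Fin p // ij.1 ≤ ij.2}) → Ω → ℝ
  | (k, Sum.inl i), ω => Z k ω i
  | (k, Sum.inr ij), ω => W k ω ij.1.1 ij.1.2

/-- For `k < K` the `Z k` are standard Gaussian vectors, the `W k` are symmetric matrices whose
upper-triangular entries, diagonal included, are standard normal, and all these are independent. -/
structure IsNewtonNoise {Ω : Type*} [MeasurableSpace Ω] {p : ℕ}
    (P : MeasureTheory.Measure Ω) (K : ℕ) (Z : ℕ → Ω → EuclideanSpace ℝ (Fin p))
    (W : ℕ → Ω → Matrix (Fin p) (Fin p) ℝ) : Prop where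
  symm : ∀ k < K, ∀ ω, (W k ω).IsSymm
  law : ∀ s, ProbabilityTheory.HasLaw (noiseEntry K Z W s)
    (ProbabilityTheory.gaussianReal 0 1) P
  indep : ProbabilityTheory.iIndepFun (noiseEntry K Z W) P

/-- The noisy gradient `n⁻¹ ∑ᵢ Ψ(xᵢ, θ) + (2 B √(2K) / (μ n)) z`. -/
noncomputable def noisyGradient {𝓧 : Type*} {p n : ℕ} (ρ : 𝓧 → EuclideanSpace ℝ (Fin p) → ℝ)
    (B μ : ℝ) (K : ℕ) (x : Fin n → 𝓧) (θ z : EuclideanSpace ℝ (Fin p)) :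
    EuclideanSpace ℝ (Fin p) :=
  (n : ℝ)⁻¹ • ∑ i, score ρ (x i) θ + (2 * B * √(2 * K) / (μ * n)) • z

/-- The noisy Hessian `n⁻¹ ∑ᵢ Ψ̇(xᵢ, θ) + (2 Bbar √(2K) / (μ n)) w`. -/
noncomputable def noisyHessian {𝓧 : Type*} {p n : ℕ} (ρ : 𝓧 → EuclideanSpace ℝ (Fin p) → ℝ)
    (Bbar μ : ℝ) (K : ℕ) (x : Fin n → 𝓧) (θ : EuclideanSpace ℝ (Fin p))
    (w : Matrix (Fin p) (Fin p) ℝ) :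
    EuclideanSpace ℝ (Fin p) →L[ℝ] EuclideanSpace ℝ (Fin p) :=
  (n : ℝ)⁻¹ • ∑ i, scoreDeriv ρ (x i) θ +
    (2 * Bbar * √(2 * K) / (μ * n)) • Matrix.toEuclideanCLM (𝕜 := ℝ) w

/-- The noisy Newton iterates `θ⁽ᵏ⁺¹⁾ = θ⁽ᵏ⁾ - η Hₖ⁻¹ gₖ` with the noisy gradient `gₖ` and the noisy
Hessian `Hₖ` at `θ⁽ᵏ⁾`, started at `θinit`, with the noise scaled for a total of `K` iterations.
(`inverse` is `0` at operators that are not invertible.) -/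
noncomputable def noisyNewton {𝓧 Ω : Type*} {p n : ℕ}
    (ρ : 𝓧 → EuclideanSpace ℝ (Fin p) → ℝ) (η B Bbar μ : ℝ) (K : ℕ)
    (θinit : EuclideanSpace ℝ (Fin p)) (Z : ℕ → Ω → EuclideanSpace ℝ (Fin p))
    (W : ℕ → Ω → Matrix (Fin p) (Fin p) ℝ) (x : Fin n → 𝓧) :
    ℕ → Ω → EuclideanSpace ℝ (Fin p)
  | 0, _ => θinit
  | k + 1, ω =>
    let θ := noisyNewton ρ η B Bbar μ K θinit Z W x k ω
    θ - η • (noisyHessian ρ Bbar μ K x θ (W k ω)).inverse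
      (noisyGradient ρ B μ K x θ (Z k ω))

end NoisyNewton

namespace NoisyNewton

open MeasureTheory ProbabilityTheory Real
open scoped NNReal ENNReal

/-! Privacy. Replacing one record moves the averaged score by d/n and, by the Gram form, the
averaged Hessian by (bbᵀ - aaᵀ)/n, which is symmetric. An update on the new data is therefore the
update on the old data with its Gaussian noise translated by a vector that depends only on the
current iterate and has squared length at most μ²/K (`exists_newtonStep_translate`). What the update
then does with its noise, inversion included, is irrelevant. Composition is carried out on the
family of bounds "power ≤ e^ε · size + δ(ε)" for all real ε. By Cameron–Martin, the log-likelihood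
ratio of a shift is Gaussian with variance its squared length. These variances add under adaptive
composition, so K shifts obey the profile δ of one shift by μ (`integral_translate_le`,
`iterate_transition_le`). Optimising over ε recovers the Gaussian trade-off curve
(`le_one_sub_gaussianTradeoff`).

Accuracy. Global convexity, from the Gram form, and strong convexity near the minimizer turn the
small initial gradient into an initial error of at most min(r/2, τ₁/(2L)). If noise matrices and
noise vectors have sizes at most εH and εg, one step gives error' ≤ 2/(3τ₁) · (L error² + εH error +
εg) (`norm_newton_step_sub_le`). The error then stays in the good region and contracts quadratically
down to the noise level, plus a term (1/3)^(2^K) (`newton_recursion`). With K of order log log n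
that term is below the noise rate D = √(Kp log(Kp/ξ))/(μn) (`pow_two_pow_le`). The noise sizes
follow from Gaussian tails and an operator norm bound for symmetric Gaussian matrices, where
averaging over a ball replaces a net argument (`lintegral_exp_norm_symMatrix_le`). -/

/-- The standard Gaussian measure on `ι → ℝ`. -/
noncomputable def gaussPi (ι : Type*) [Fintype ι] : Measure (ι → ℝ) :=
  Measure.pi fun _ => gaussianReal 0 1

/-! ### Translations and linear images of the standard Gaussian measure -/

section GaussPi

variable {ι : Type*} [Fintype ι]

instance : IsProbabilityMeasure (gaussPi ι) := by
  unfold gaussPi; infer_instance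

lemma gaussianReal_withDensity_exp (v : ℝ) :
    (gaussianReal 0 1).withDensity (fun z => ENNReal.ofReal (exp (v * z - v ^ 2 / 2))) =
      gaussianReal v 1 := by
  rw [gaussianReal_of_var_ne_zero _ one_ne_zero, gaussianReal_of_var_ne_zero _ one_ne_zero,
    ← withDensity_mul _ (measurable_gaussianPDF _ _) (by fun_prop)]
  congr 1
  ext z
  simp only [Pi.mul_apply, gaussianPDF, gaussianPDFReal]
  rw [← ENNReal.ofReal_mul (by positivity), mul_assoc, ← exp_add]
  congr 3
  simp only [NNReal.coe_one]
  ring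

/-- Cameron–Martin in finite dimension: the density factors over coordinates, and each factor is a
one-dimensional exponential tilt, which shifts the mean. -/
lemma gaussPi_withDensity_exp (v : ι → ℝ) :
    (gaussPi ι).withDensity
        (fun z => ENNReal.ofReal (exp (∑ i, v i * z i - (∑ i, v i ^ 2) / 2))) =
      (gaussPi ι).map (fun z => z + v) := by
  have h1 : (gaussPi ι).map (fun z => z + v) = Measure.pi fun i => gaussianReal (v i) 1 := by
    have := Measure.pi_map_pi (μ := fun _ : ι => gaussianReal 0 1) (f := fun i z => z + v i)
      (fun i => by fun_prop)
    simp only [gaussianReal_map_add_const, zero_add] at this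
    exact this
  rw [h1]
  symm
  refine Measure.pi_eq fun s hs => ?_
  rw [withDensity_apply _ (MeasurableSet.univ_pi hs),
    ← lintegral_indicator (MeasurableSet.univ_pi hs)]
  have h2 : ∀ z : ι → ℝ, (Set.univ.pi s).indicator
      (fun z => ENNReal.ofReal (exp (∑ i, v i * z i - (∑ i, v i ^ 2) / 2))) z =
      ∏ i, (s i).indicator (fun y => ENNReal.ofReal (exp (v i * y - v i ^ 2 / 2))) (z i) := by
    intro z
    classical
    by_cases hz : z ∈ Set.univ.pi s
    · rw [Set.indicator_of_mem hz]
      have : ∀ i, z i ∈ s i := fun i => hz i trivial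
      simp only [Set.indicator_of_mem (this _)]
      rw [← ENNReal.ofReal_prod_of_nonneg (fun i _ => (exp_pos _).le), ← exp_sum,
        Finset.sum_sub_distrib, Finset.sum_div]
    · rw [Set.indicator_of_notMem hz]
      simp only [Set.mem_pi, Set.mem_univ, true_imp_iff, not_forall] at hz
      obtain ⟨i, hi⟩ := hz
      exact (Finset.prod_eq_zero (Finset.mem_univ i) (Set.indicator_of_notMem hi _)).symm
  simp only [h2]
  have h3 : iIndepFun (fun i (z : ι → ℝ) =>
      (s i).indicator (fun y => ENNReal.ofReal (exp (v i * y - v i ^ 2 / 2))) (z i)) (gaussPi ι) :=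
    iIndepFun_pi (μ := fun _ : ι => gaussianReal 0 1) fun i =>
      (Measurable.indicator (by fun_prop) (hs i)).aemeasurable
  rw [lintegral_prod_eq_prod_lintegral_of_indepFun _ _ h3 fun i =>
    (Measurable.indicator (by fun_prop) (hs i)).comp (measurable_pi_apply i)]
  refine Finset.prod_congr rfl fun i _ => ?_
  rw [← gaussianReal_withDensity_exp, withDensity_apply _ (hs i), ← lintegral_indicator (hs i)]
  exact (measurePreserving_eval (fun _ : ι => gaussianReal 0 1) i).lintegral_comp
    (Measurable.indicator (by fun_prop) (hs i))

/-- Change of variables for a translation of the standard Gaussian measure. -/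
lemma integral_gaussPi_translate (v : ι → ℝ) (g : (ι → ℝ) → ℝ) :
    ∫ z, exp (-(∑ i, v i * z i) - (∑ i, v i ^ 2) / 2) * g (z + v) ∂gaussPi ι =
      ∫ z, g z ∂gaussPi ι := by
  set G : (ι → ℝ) → ℝ := fun y => exp (-(∑ i, v i * y i) + (∑ i, v i ^ 2) / 2) * g y with hG
  have h0 : ∀ z, exp (-(∑ i, v i * z i) - (∑ i, v i ^ 2) / 2) * g (z + v) = G (z + v) := by
    intro z
    simp only [hG, Pi.add_apply, mul_add, Finset.sum_add_distrib]
    congr 2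
    have : ∑ i, v i * v i = ∑ i, v i ^ 2 := by simp only [sq]
    rw [this]; ring
  -- A translation is a measurable embedding, so the change of variables needs no measurability of
  -- `g`.
  have he : MeasurableEmbedding (fun z : ι → ℝ => z + v) := measurableEmbedding_addRight v
  simp only [h0]
  rw [← he.integral_map (μ := gaussPi ι) (g := G), ← gaussPi_withDensity_exp,
    integral_withDensity_eq_integral_toReal_smul (by fun_prop) (by simp)]
  refine integral_congr_ae (Filter.Eventually.of_forall fun z => ?_)
  simp only [hG, smul_eq_mul]
  rw [ENNReal.toReal_ofReal (exp_pos _).le, ← mul_assoc, ← exp_add]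
  ring_nf
  simp

/-- The characteristic function of the image factors over the independent coordinates. -/
lemma gaussPi_map_linear (v : ι → ℝ) :
    (gaussPi ι).map (fun z => ∑ i, v i * z i) = gaussianReal 0 (∑ i, ‖v i‖₊ ^ 2) := by
  refine Measure.ext_of_charFun ?_
  ext t
  rw [charFun_apply, integral_map (Measurable.aemeasurable (by fun_prop)) (by fun_prop), charFun_gaussianReal]
  have : ∀ z : ι → ℝ, Complex.exp ((inner ℝ (∑ i, v i * z i) t : ℝ) * Complex.I) =
      ∏ i, Complex.exp ((inner ℝ (z i) (v i * t) : ℝ) * Complex.I) := by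
    intro z
    rw [← Complex.exp_sum]
    congr 1
    rw [← Finset.sum_mul]
    congr 1
    simp only [RCLike.inner_apply, conj_trivial]
    push_cast
    rw [Finset.mul_sum]
    exact Finset.sum_congr rfl fun i _ => by ring
  simp only [this]
  rw [gaussPi, integral_fintype_prod_eq_prod
    (f := fun i (y : ℝ) => Complex.exp ((inner ℝ y (v i * t) : ℝ) * Complex.I))]
  have h2 : ∀ i, ∫ y, Complex.exp ((inner ℝ y (v i * t) : ℝ) * Complex.I) ∂gaussianReal 0 1 =
      Complex.exp (-((v i ^ 2 : ℝ) * t ^ 2 / 2)) := by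
    intro i
    rw [← charFun_apply, charFun_gaussianReal]
    congr 1
    push_cast
    ring
  simp only [h2]
  rw [← Complex.exp_sum]
  congr 1
  push_cast
  simp only [Finset.sum_neg_distrib, Finset.sum_mul, Finset.sum_div]
  simp [← Complex.ofReal_pow]

end GaussPi

/-! ### Hockey-stick profiles and adaptive composition -/

/-- The hockey-stick profile of a Gaussian shift of squared size `s`. -/
noncomputable def gaussHockey (s : ℝ≥0) (ε : ℝ) : ℝ :=
  ∫ y, max 0 (1 - exp (ε - y - s / 2)) ∂gaussianReal 0 s

lemma max_zero_one_sub_exp_le (x : ℝ) : max 0 (1 - exp x) ≤ 1 :=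
  max_le zero_le_one (by linarith [exp_pos x])

lemma integrable_hockey {Ω : Type*} [MeasurableSpace Ω] (P : Measure Ω) [IsFiniteMeasure P]
    {f : Ω → ℝ} (hf : Measurable f) : Integrable (fun ω => max 0 (1 - exp (f ω))) P := by
  refine Integrable.of_bound (C := 1) (by fun_prop) (Filter.Eventually.of_forall fun ω => ?_)
  rw [norm_of_nonneg (le_max_left _ _)]
  exact max_zero_one_sub_exp_le _

lemma gaussHockey_nonneg (s : ℝ≥0) (ε : ℝ) : 0 ≤ gaussHockey s ε :=
  integral_nonneg fun _ => le_max_left _ _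

lemma gaussHockey_zero (ε : ℝ) : gaussHockey 0 ε = max 0 (1 - exp ε) := by
  simp [gaussHockey]

/-- The composition law: the profile depends on the shift only through a centred Gaussian of
variance `s`, and these Gaussians form a convolution semigroup. -/
lemma gaussHockey_add (s t : ℝ≥0) (ε : ℝ) :
    ∫ y, gaussHockey s (ε - y - t / 2) ∂gaussianReal 0 t = gaussHockey (s + t) ε := by
  have h := gaussianReal_conv_gaussianReal (m₁ := 0) (m₂ := 0) (v₁ := t) (v₂ := s)
  rw [gaussHockey, add_comm s t]
  rw [add_zero] at h
  rw [← h, integral_conv]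
  · refine integral_congr_ae (Filter.Eventually.of_forall fun x => ?_)
    simp only [gaussHockey]
    refine integral_congr_ae (Filter.Eventually.of_forall fun y => ?_)
    simp only
    congr 3
    push_cast
    ring
  · exact integrable_hockey _ (by fun_prop)

lemma integrable_gaussHockey_comp {Ω : Type*} [MeasurableSpace Ω] (P : Measure Ω)
    [IsFiniteMeasure P] (s : ℝ≥0) {f : Ω → ℝ} (hf : Measurable f) :
    Integrable (fun ω => gaussHockey s (f ω)) P := by
  refine Integrable.of_bound (C := 1) ?_ (Filter.Eventually.of_forall fun ω => ?_)
  · unfold gaussHockey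
    have : StronglyMeasurable (fun q : Ω × ℝ => max 0 (1 - exp (f q.1 - q.2 - s / 2))) :=
      Measurable.stronglyMeasurable (by fun_prop)
    exact this.integral_prod_right.aestronglyMeasurable
  · rw [norm_of_nonneg (gaussHockey_nonneg _ _)]
    refine (integral_mono (integrable_hockey _ (by fun_prop)) (integrable_const 1)
      fun y => max_zero_one_sub_exp_le _).trans ?_
    simp

lemma integral_exp_neg_gaussianReal (t : ℝ≥0) (c : ℝ) :
    Integrable (fun y => exp (c - y - t / 2)) (gaussianReal 0 t) ∧
    ∫ y, exp (c - y - t / 2) ∂gaussianReal 0 t = exp c := by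
  have h1 : ∀ y : ℝ, exp (c - y - t / 2) = exp (c - t / 2) * exp ((-1) * y) := by
    intro y; rw [← exp_add]; congr 1; ring
  have h2 := congrFun (mgf_id_gaussianReal (μ := 0) (v := t)) (-1)
  simp only [mgf, id] at h2
  constructor
  · simp only [h1]
    exact (integrable_exp_mul_gaussianReal (-1)).const_mul _
  · simp only [h1]
    rw [integral_const_mul, h2, ← exp_add]
    congr 1; ring

/-- Jensen for the positive part: averaging `exp (c - y - t / 2)` over a centred Gaussian of
variance `t` returns `exp c`, so the extra shift only spreads out the argument of a convex function.
-/
lemma gaussHockey_le_add (s t : ℝ≥0) (ε : ℝ) : gaussHockey s ε ≤ gaussHockey (s + t) ε := by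
  rw [← add_comm t s, ← gaussHockey_add]
  refine integral_mono (integrable_hockey _ (by fun_prop))
    (integrable_gaussHockey_comp _ _ (by fun_prop)) fun y => ?_
  simp only
  obtain ⟨hi, he⟩ := integral_exp_neg_gaussianReal t (ε - y - s / 2)
  refine max_le (gaussHockey_nonneg _ _) ?_
  rw [← he]
  have : (1 : ℝ) = ∫ _y : ℝ, (1 : ℝ) ∂gaussianReal 0 t := by simp
  rw [this, ← integral_sub (integrable_const 1) hi]
  exact integral_mono ((integrable_const 1).sub hi) (integrable_hockey _ (by fun_prop))
    fun x => le_max_right _ _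

lemma gaussHockey_mono {s t : ℝ≥0} (h : s ≤ t) (ε : ℝ) : gaussHockey s ε ≤ gaussHockey t ε := by
  obtain ⟨r, rfl⟩ := exists_add_of_le h
  exact gaussHockey_le_add s r ε

lemma integrable_exp_gaussPi {ι : Type*} [Fintype ι] (v : ι → ℝ) (c : ℝ) :
    Integrable (fun z : ι → ℝ => exp (c - ∑ i, v i * z i)) (gaussPi ι) := by
  have h : Integrable (fun y => exp (-1 * y)) ((gaussPi ι).map (fun z => ∑ i, v i * z i)) := by
    rw [gaussPi_map_linear]; exact integrable_exp_mul_gaussianReal (-1)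
  have h2 := (h.comp_measurable (f := fun z : ι → ℝ => ∑ i, v i * z i) (by fun_prop)).const_mul
    (exp c)
  refine h2.congr (Filter.Eventually.of_forall fun z => ?_)
  simp only [Function.comp]
  rw [← exp_add]; congr 1; ring

/-- One adaptive composition step: a hockey-stick bound on the later stages is combined with a
translation of the Gaussian noise of the present one. -/
lemma integral_translate_le {ι : Type*} [Fintype ι] (v : ι → ℝ) (s t : ℝ≥0)
    (hv : ∑ i, v i ^ 2 ≤ t) {ψ ψ' : (ι → ℝ) → ℝ} (hψ : Measurable ψ) (hψ' : Measurable ψ')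
    (hψ01 : ∀ z, ψ z ∈ Set.Icc (0 : ℝ) 1) (hψ01' : ∀ z, ψ' z ∈ Set.Icc (0 : ℝ) 1)
    (h : ∀ ε z, ψ' z ≤ exp ε * ψ z + gaussHockey s ε) (ε : ℝ) :
    ∫ z, ψ' (z + v) ∂gaussPi ι ≤ exp ε * ∫ z, ψ z ∂gaussPi ι + gaussHockey (s + t) ε := by
  set w : ℝ≥0 := ∑ i, ‖v i‖₊ ^ 2 with hw
  have hwv : (w : ℝ) = ∑ i, v i ^ 2 := by simp [hw]
  have hwt : w ≤ t := by rw [← NNReal.coe_le_coe, hwv]; exact hv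
  -- The hypothesis is applied at a level depending on `z`: `ε` corrected by the log-likelihood
  -- ratio of the translation. The exponential weight then undoes the translation of `ψ`, and the
  -- Gaussian law of `∑ i, v i * z i` turns the remainder into `gaussHockey (s + w) ε`.
  set e : (ι → ℝ) → ℝ := fun z => ε - (∑ i, v i * z i) - w / 2 with he
  have hem : Measurable e := by fun_prop
  have hint : Integrable (fun z => exp (e z) * ψ (z + v)) (gaussPi ι) := by
    have h1 := integrable_exp_gaussPi v (ε - w / 2)
    refine h1.mono' ?_ (Filter.Eventually.of_forall fun z => ?_)
    · exact (hem.exp.mul (hψ.comp (by fun_prop))).aestronglyMeasurable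
    · rw [norm_mul, norm_of_nonneg (exp_pos _).le, norm_of_nonneg (hψ01 _).1]
      have : e z = ε - w / 2 - ∑ i, v i * z i := by simp only [he]; ring
      rw [this]
      exact mul_le_of_le_one_right (exp_pos _).le (hψ01 _).2
  calc ∫ z, ψ' (z + v) ∂gaussPi ι
      ≤ ∫ z, (exp (e z) * ψ (z + v) + gaussHockey s (e z)) ∂gaussPi ι := by
        refine integral_mono ?_ (hint.add (integrable_gaussHockey_comp _ _ hem))
          fun z => h (e z) (z + v)
        refine Integrable.of_bound (C := 1)
          (hψ'.comp (by fun_prop)).aestronglyMeasurable (Filter.Eventually.of_forall fun z => ?_)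
        rw [norm_of_nonneg (hψ01' _).1]
        exact (hψ01' _).2
    _ = exp ε * ∫ z, ψ z ∂gaussPi ι + gaussHockey (s + w) ε := by
        rw [integral_add hint (integrable_gaussHockey_comp _ _ hem)]
        congr 1
        · rw [← integral_gaussPi_translate v ψ, ← integral_const_mul]
          refine integral_congr_ae (Filter.Eventually.of_forall fun z => ?_)
          simp only [he]
          rw [← mul_assoc, ← exp_add, hwv]
          ring_nf
        · rw [← gaussHockey_add, hw, ← gaussPi_map_linear, integral_map (Measurable.aemeasurable (by fun_prop))]
          have := (integrable_gaussHockey_comp (gaussianReal 0 w) s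
            (f := fun y => ε - y - w / 2) (by fun_prop)).aestronglyMeasurable
          rw [hw, ← gaussPi_map_linear] at this
          exact this
    _ ≤ _ := by
        gcongr
        exact gaussHockey_mono (by gcongr) ε

/-- The transition operator of the Markov chain that updates `θ` to `U θ z` with fresh standard
Gaussian noise `z`. -/
noncomputable def transition {E ι : Type*} [Fintype ι] (U : E → (ι → ℝ) → E) (φ : E → ℝ) (θ : E) :
    ℝ :=
  ∫ z, φ (U θ z) ∂gaussPi ι

section Transition

variable {E ι : Type*} [MeasurableSpace E] [Fintype ι] {U U' : E → (ι → ℝ) → E}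

lemma measurable_transition (hU : Measurable U.uncurry) {φ : E → ℝ} (hφ : Measurable φ) :
    Measurable (transition U φ) := by
  have : StronglyMeasurable (fun q : E × (ι → ℝ) => φ (U q.1 q.2)) :=
    (hφ.comp hU).stronglyMeasurable
  exact this.integral_prod_right.measurable

lemma transition_mem_Icc {φ : E → ℝ} (hU : Measurable U.uncurry) (hφ : Measurable φ)
    (h : ∀ e, φ e ∈ Set.Icc (0 : ℝ) 1) (θ : E) : transition U φ θ ∈ Set.Icc (0 : ℝ) 1 := by
  refine ⟨integral_nonneg fun z => (h _).1, ?_⟩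
  have hm : Measurable fun z => φ (U θ z) := hφ.comp (hU.comp measurable_prodMk_left)
  refine (integral_mono (g := fun _ => (1 : ℝ)) ?_ (integrable_const 1) fun z => (h _).2).trans
    (by simp)
  refine Integrable.of_bound (C := 1) hm.aestronglyMeasurable
    (Filter.Eventually.of_forall fun z => ?_)
  rw [norm_of_nonneg (h _).1]
  exact (h _).2

lemma iterate_transition_mem_Icc {φ : E → ℝ} (hU : Measurable U.uncurry) (hφ : Measurable φ)
    (h : ∀ e, φ e ∈ Set.Icc (0 : ℝ) 1) (k : ℕ) :
    Measurable ((transition U)^[k] φ) ∧ ∀ θ, (transition U)^[k] φ θ ∈ Set.Icc (0 : ℝ) 1 := by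
  induction k with
  | zero => exact ⟨hφ, h⟩
  | succ k ih =>
    rw [Function.iterate_succ_apply']
    exact ⟨measurable_transition hU ih.1, transition_mem_Icc hU ih.1 ih.2⟩

/-- Adaptive composition of Gaussian shifts: `K` updates, each of which differs by a translation
of squared length at most `t` of its noise. -/
theorem iterate_transition_le (hU : Measurable U.uncurry) (hU' : Measurable U'.uncurry)
    (v : E → ι → ℝ) (t : ℝ≥0) (hv : ∀ θ, ∑ i, v θ i ^ 2 ≤ t)
    (hUU' : ∀ θ z, U' θ z = U θ (z + v θ)) {φ : E → ℝ} (hφ : Measurable φ)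
    (h : ∀ e, φ e ∈ Set.Icc (0 : ℝ) 1) (k : ℕ) (ε : ℝ) (θ : E) :
    (transition U')^[k] φ θ ≤ exp ε * (transition U)^[k] φ θ + gaussHockey (k * t) ε := by
  induction k generalizing ε θ with
  | zero =>
    simp only [Function.iterate_zero, id, Nat.cast_zero, zero_mul, gaussHockey_zero]
    obtain ⟨h0, h1⟩ := h θ
    rcases le_total 1 (exp ε) with h2 | h2
    · have := le_max_left 0 (1 - exp ε)
      nlinarith
    · have := le_max_right 0 (1 - exp ε)
      nlinarith
  | succ k ih =>
    -- The outermost operator is the first update. The remaining `k` are compared by the induction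
    -- hypothesis at every level and every starting point, which is what adaptivity requires.
    rw [Function.iterate_succ_apply', Function.iterate_succ_apply']
    obtain ⟨m, b⟩ := iterate_transition_mem_Icc hU hφ h k
    obtain ⟨m', b'⟩ := iterate_transition_mem_Icc hU' hφ h k
    have hUθ : Measurable (U θ) := hU.comp measurable_prodMk_left
    have key := integral_translate_le (v θ) (k * t) t (hv θ)
      (ψ := fun z => (transition U)^[k] φ (U θ z)) (ψ' := fun z => (transition U')^[k] φ (U θ z))
      (m.comp hUθ) (m'.comp hUθ) (fun _ => b _) (fun _ => b' _) (fun ε z => ih ε (U θ z)) ε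
    have hc : ((k + 1 : ℕ) : ℝ≥0) * t = k * t + t := by push_cast; ring
    rw [hc]
    simp only [← hUU'] at key
    exact key

end Transition

/-! ### From hockey-stick bounds to the Gaussian trade-off curve -/

lemma continuous_stdNormalCDF : Continuous stdNormalCDF := by
  have : NullSingletonClass (gaussianReal 0 1) := nullSingletonClass_gaussianReal one_ne_zero
  rw [continuous_iff_continuousAt]
  intro x
  have hm : Monotone stdNormalCDF := fun a b h => monotone_cdf (gaussianReal 0 1) h
  rw [hm.continuousAt_iff_leftLim_eq_rightLim]
  have h1 : Function.rightLim stdNormalCDF x = stdNormalCDF x :=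
    (cdf (gaussianReal 0 1)).rightLim_eq x
  have h2 := (cdf (gaussianReal 0 1)).measure_singleton x
  rw [measure_cdf, measure_singleton] at h2
  have h3 : Function.leftLim stdNormalCDF x ≤ stdNormalCDF x := hm.leftLim_le le_rfl
  have h4 : stdNormalCDF x - Function.leftLim stdNormalCDF x ≤ 0 := by
    exact ENNReal.ofReal_eq_zero.1 h2.symm
  rw [h1]
  linarith

/-- The infimum is attained because the superlevel set is closed. A strict inequality there would,
by continuity, put a smaller point in the set. -/
lemma stdNormalCDF_quantile {u : ℝ} (h0 : 0 < u) (h1 : u < 1) :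
    stdNormalCDF (stdNormalQuantile u) = u := by
  set S := {t : ℝ | u ≤ stdNormalCDF t} with hS
  have hm : Monotone stdNormalCDF := fun a b h => monotone_cdf (gaussianReal 0 1) h
  have hne : S.Nonempty := by
    have := (tendsto_cdf_atTop (gaussianReal 0 1)).eventually (lt_mem_nhds h1)
    obtain ⟨t, ht⟩ := this.exists
    exact ⟨t, le_of_lt ht⟩
  have hbdd : BddBelow S := by
    have := (tendsto_cdf_atBot (gaussianReal 0 1)).eventually (gt_mem_nhds h0)
    obtain ⟨t, ht⟩ := this.exists
    refine ⟨t, fun s hs => ?_⟩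
    by_contra hlt
    have := hm (not_le.1 hlt).le
    have h2 : u ≤ stdNormalCDF s := hs
    have h3 : stdNormalCDF t < u := ht
    linarith
  have hcl : IsClosed S := isClosed_le continuous_const continuous_stdNormalCDF
  have hmem : sInf S ∈ S := hcl.csInf_mem hne hbdd
  refine le_antisymm ?_ hmem
  by_contra hlt
  have h2 : u < stdNormalCDF (sInf S) := not_le.1 hlt
  have h3 := (continuous_stdNormalCDF.tendsto (sInf S)).eventually (lt_mem_nhds h2)
  obtain ⟨δ, hδ, hb⟩ := Metric.eventually_nhds_iff.1 h3
  have h4 : u < stdNormalCDF (sInf S - δ / 2) := hb (by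
    rw [Real.dist_eq, sub_sub_cancel_left, abs_neg, abs_of_pos (by positivity)]; linarith)
  have := csInf_le hbdd (show sInf S - δ / 2 ∈ S from h4.le)
  linarith

lemma gaussianReal_real_Ioi (t : ℝ) : (gaussianReal 0 1).real (Set.Ioi t) = 1 - stdNormalCDF t := by
  rw [stdNormalCDF, cdf_eq_real, ← Set.compl_Iic, probReal_compl_eq_one_sub measurableSet_Iic]

/-- The value of the hockey-stick profile at the level whose optimal test has threshold `t`. -/
lemma gaussHockey_eq {m : ℝ} (hm : 0 < m) (t : ℝ) :
    gaussHockey (‖m‖₊ ^ 2) (m * t - m ^ 2 / 2) =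
      (1 - stdNormalCDF (t - m)) - exp (m * t - m ^ 2 / 2) * (1 - stdNormalCDF t) := by
  have hmap : gaussianReal 0 (‖m‖₊ ^ 2) = (gaussianReal 0 1).map (fun z => m * z) := by
    rw [gaussianReal_map_const_mul]
    congr 1
    · simp
    · ext; simp
  have hm2 : ((‖m‖₊ ^ 2 : ℝ≥0) : ℝ) = m ^ 2 := by simp
  have hE : ∀ z, exp (m * t - m ^ 2 / 2 - m * z - m ^ 2 / 2) =
      exp (m * t - m ^ 2 / 2) * exp (-(m * z) - m ^ 2 / 2) := by
    intro z; rw [← exp_add]; ring_nf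
  set e := exp (m * t - m ^ 2 / 2)
  -- change of variables for the second term
  have hcv : ∫ z, (Set.Ioi (t - m)).indicator (fun z => exp (-(m * z) - m ^ 2 / 2)) z
      ∂gaussianReal 0 1 = 1 - stdNormalCDF t := by
    rw [integral_indicator measurableSet_Ioi, ← gaussianReal_real_Ioi]
    have h1 := gaussianReal_withDensity_exp (-m)
    have h2 : (gaussianReal 0 1).real (Set.Ioi t) = (gaussianReal (-m) 1).real (Set.Ioi (t - m)) := by
      have := gaussianReal_map_add_const (μ := 0) (v := 1) (-m)
      rw [zero_add] at this
      rw [← this, map_measureReal_apply (by fun_prop) measurableSet_Ioi]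
      congr 1
      ext z
      simp
    rw [h2, ← h1, measureReal_def, withDensity_apply _ measurableSet_Ioi,
      ← ofReal_integral_eq_lintegral_ofReal, ENNReal.toReal_ofReal]
    · refine integral_congr_ae (Filter.Eventually.of_forall fun z => ?_)
      simp only
      congr 1
      ring
    · exact integral_nonneg fun _ => (exp_pos _).le
    · have := (integrable_exp_mul_gaussianReal (μ := 0) (v := 1) (-m)).const_mul
        (exp (-(m ^ 2 / 2)))
      refine (this.congr (Filter.Eventually.of_forall fun z => ?_)).restrict
      simp only
      rw [← exp_add]
      congr 1
      ring
    · exact Filter.Eventually.of_forall fun _ => (exp_pos _).le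
  have hint : Integrable ((Set.Ioi (t - m)).indicator (fun z => exp (-(m * z) - m ^ 2 / 2)))
      (gaussianReal 0 1) := by
    refine Integrable.indicator ?_ measurableSet_Ioi
    have := (integrable_exp_mul_gaussianReal (μ := 0) (v := 1) (-m)).const_mul
      (exp (-(m ^ 2 / 2)))
    refine this.congr (Filter.Eventually.of_forall fun z => ?_)
    simp only
    rw [← exp_add]
    congr 1
    ring
  -- The positive part is active exactly for `z > t - m`, the rejection region of the likelihood
  -- ratio test.
  have hpt : ∀ z, max 0 (1 - exp (m * t - m ^ 2 / 2 - m * z - m ^ 2 / 2)) =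
      (Set.Ioi (t - m)).indicator (fun _ => (1 : ℝ)) z -
        e * (Set.Ioi (t - m)).indicator (fun z => exp (-(m * z) - m ^ 2 / 2)) z := by
    intro z
    by_cases hz : z ∈ Set.Ioi (t - m)
    · rw [Set.indicator_of_mem hz, Set.indicator_of_mem hz, ← hE]
      refine max_eq_right ?_
      rw [sub_nonneg, exp_le_one_iff]
      have : t - m < z := hz
      nlinarith
    · rw [Set.indicator_of_notMem hz, Set.indicator_of_notMem hz]
      rw [mul_zero, sub_zero]
      refine max_eq_left ?_
      rw [sub_nonpos, one_le_exp_iff]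
      have : z ≤ t - m := not_lt.1 hz
      nlinarith
  rw [gaussHockey, hm2, hmap, integral_map (by fun_prop)
    (Measurable.aestronglyMeasurable (by fun_prop))]
  simp only [hpt]
  rw [integral_sub ((integrable_const _).indicator measurableSet_Ioi) (hint.const_mul _),
    integral_const_mul, hcv, integral_indicator_const _ measurableSet_Ioi, gaussianReal_real_Ioi]
  simp

/-- A pair of size and power that satisfies all hockey-stick bounds of the Gaussian shift by `m`
lies below the Gaussian trade-off curve. -/
lemma le_one_sub_gaussianTradeoff {m a b α : ℝ} (hm : 0 < m) (ha : 0 ≤ a) (hb1 : b ≤ 1)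
    (h : ∀ ε, b ≤ exp ε * a + gaussHockey (‖m‖₊ ^ 2) ε) (haα : a ≤ α) :
    b ≤ 1 - gaussianTradeoff m α := by
  -- Levels are parametrised by the threshold `t`. The last summand is nonpositive as soon as `a ≤ 1
  -- - Φ(t)`, so `t = Φ⁻¹(1 - α)` is the right choice for `0 < α < 1`.
  have key : ∀ t, b ≤ (1 - stdNormalCDF (t - m)) +
      exp (m * t - m ^ 2 / 2) * (a - (1 - stdNormalCDF t)) := by
    intro t
    have := h (m * t - m ^ 2 / 2)
    rw [gaussHockey_eq hm] at this
    linarith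
  unfold gaussianTradeoff
  split_ifs with h1 h2
  · have ha0 : a = 0 := le_antisymm (haα.trans h1) ha
    have h3 : ∀ t, b ≤ 1 - stdNormalCDF (t - m) := by
      intro t
      refine (key t).trans ?_
      have h5 : stdNormalCDF t ≤ 1 := cdf_le_one _ _
      have := mul_nonneg (exp_pos (m * t - m ^ 2 / 2)).le (sub_nonneg.2 h5)
      rw [ha0]
      linarith
    -- At size zero every threshold is admissible, and letting it tend to infinity forces the power
    -- to be zero.
    have h4 : Filter.Tendsto (fun t => 1 - stdNormalCDF t) Filter.atTop (nhds (1 - 1)) :=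
      (tendsto_cdf_atTop (gaussianReal 0 1)).const_sub 1
    refine ge_of_tendsto' h4 fun t => ?_
    simpa using h3 (t + m)
  · linarith
  · rw [not_le] at h1 h2
    have := key (stdNormalQuantile (1 - α))
    rw [stdNormalCDF_quantile (by linarith) (by linarith)] at this
    have h5 := mul_nonneg (exp_pos (m * stdNormalQuantile (1 - α) - m ^ 2 / 2)).le
      (sub_nonneg.2 haα)
    linarith

/-! ### Derivatives of the empirical risk -/

section EmpiricalRisk

variable {𝓧 : Type*} {p n : ℕ} {ρ : 𝓧 → EuclideanSpace ℝ (Fin p) → ℝ}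

lemma gradient_empRisk (h : ∀ x, Differentiable ℝ (ρ x)) (x : Fin n → 𝓧) :
    gradient (empRisk ρ x) = fun θ => (n : ℝ)⁻¹ • ∑ i, score ρ (x i) θ := by
  ext1 θ
  have h1 : HasFDerivAt (empRisk ρ x) ((n : ℝ)⁻¹ • ∑ i, fderiv ℝ (ρ (x i)) θ) θ :=
    (HasFDerivAt.fun_sum fun i _ => (h (x i) θ).hasFDerivAt).const_mul _
  simp only [gradient, score, h1.fderiv]
  rw [map_smulₛₗ, map_sum]
  simp

lemma differentiable_gradient_empRisk (h : ∀ x, Differentiable ℝ (ρ x))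
    (h2 : ∀ x, Differentiable ℝ (score ρ x)) (x : Fin n → 𝓧) :
    Differentiable ℝ (gradient (empRisk ρ x)) := by
  rw [gradient_empRisk h]
  exact Differentiable.fun_const_smul (Differentiable.fun_sum fun i _ => h2 (x i)) _

lemma hessian_empRisk (h : ∀ x, Differentiable ℝ (ρ x))
    (h2 : ∀ x, Differentiable ℝ (score ρ x)) (x : Fin n → 𝓧) (θ : EuclideanSpace ℝ (Fin p)) :
    hessian (empRisk ρ x) θ = (n : ℝ)⁻¹ • ∑ i, scoreDeriv ρ (x i) θ := by
  have h1 : HasFDerivAt (fun θ => (n : ℝ)⁻¹ • ∑ i, score ρ (x i) θ)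
      ((n : ℝ)⁻¹ • ∑ i, fderiv ℝ (score ρ (x i)) θ) θ :=
    HasFDerivAt.fun_const_smul (HasFDerivAt.fun_sum fun i _ => (h2 (x i) θ).hasFDerivAt) _
  rw [hessian, gradient_empRisk h, h1.fderiv]
  rfl

end EmpiricalRisk

/-! ### The update as a function of scalar noise, and the law of the iterates -/

/-- The index set of the scalar noise variables of one iteration. -/
abbrev NoiseIdx (p : ℕ) : Type := Fin p ⊕ {ij : Fin p × Fin p // ij.1 ≤ ij.2}

/-- The symmetric matrix with given upper-triangular entries. -/
def symMatrix {p : ℕ} (w : {ij : Fin p × Fin p // ij.1 ≤ ij.2} → ℝ) : Matrix (Fin p) (Fin p) ℝ :=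
  Matrix.of fun i j => w ⟨(min i j, max i j), min_le_max⟩

lemma symMatrix_add {p : ℕ} (w w' : {ij : Fin p × Fin p // ij.1 ≤ ij.2} → ℝ) :
    symMatrix (w + w') = symMatrix w + symMatrix w' := rfl

lemma symMatrix_of_isSymm {p : ℕ} {M : Matrix (Fin p) (Fin p) ℝ} (hM : M.IsSymm) :
    symMatrix (fun ij => M ij.1.1 ij.1.2) = M := by
  ext i j
  simp only [symMatrix, Matrix.of_apply]
  rcases le_total i j with h | h
  · rw [min_eq_left h, max_eq_right h]
  · rw [min_eq_right h, max_eq_left h]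
    exact hM.apply i j

lemma isSymm_symMatrix {p : ℕ} (w : {ij : Fin p × Fin p // ij.1 ≤ ij.2} → ℝ) :
    (symMatrix w).IsSymm := by
  ext i j
  simp only [symMatrix, Matrix.transpose_apply, Matrix.of_apply]
  congr 3
  · exact min_comm _ _
  · exact max_comm _ _

/-- One noisy Newton update, as a function of the current iterate and the scalar noise variables. -/
noncomputable def newtonStep {𝓧 : Type*} {p n : ℕ} (ρ : 𝓧 → EuclideanSpace ℝ (Fin p) → ℝ)
    (B Bbar μ : ℝ) (K : ℕ) (x : Fin n → 𝓧) (θ : EuclideanSpace ℝ (Fin p)) (z : NoiseIdx p → ℝ) :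
    EuclideanSpace ℝ (Fin p) :=
  θ - (noisyHessian ρ Bbar μ K x θ (symMatrix (z ∘ Sum.inr))).inverse
      (noisyGradient ρ B μ K x θ (WithLp.toLp 2 (z ∘ Sum.inl)))

/-- The scalar noise variables of iteration `k`. -/
def noiseBlock {Ω : Type*} {p : ℕ} (Z : ℕ → Ω → EuclideanSpace ℝ (Fin p))
    (W : ℕ → Ω → Matrix (Fin p) (Fin p) ℝ) (k : ℕ) (ω : Ω) : NoiseIdx p → ℝ :=
  Sum.elim (fun i => Z k ω i) (fun ij => W k ω ij.1.1 ij.1.2)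

section Measurability

/-- Inversion is continuous on the open set of units and constantly `0` off it. -/
lemma measurable_clm_inverse {E : Type*} [NormedAddCommGroup E] [NormedSpace ℝ E]
    [CompleteSpace E] :
    Measurable (ContinuousLinearMap.inverse : (E →L[ℝ] E) → (E →L[ℝ] E)) := by
  classical
  rw [← ContinuousLinearMap.ringInverse_eq_inverse]
  have h1 : ContinuousOn Ring.inverse {A : E →L[ℝ] E | IsUnit A} := fun A hA => by
    obtain ⟨u, rfl⟩ := hA
    exact (NormedRing.inverse_continuousAt u).continuousWithinAt
  have h2 : MeasurableSet {A : E →L[ℝ] E | IsUnit A} := Units.isOpen.measurableSet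
  have h3 := h1.measurable_piecewise (g := fun _ => 0) continuousOn_const h2
  convert h3 using 1
  ext1 A
  by_cases hA : IsUnit A
  · rw [Set.piecewise_eq_of_mem _ _ _ (show A ∈ {A | IsUnit A} from hA)]
  · rw [Set.piecewise_eq_of_notMem _ _ _ (show A ∉ {A | IsUnit A} from hA), Ring.inverse_non_unit _ hA]

variable {𝓧 : Type*} {p n : ℕ} (ρ : 𝓧 → EuclideanSpace ℝ (Fin p) → ℝ)

lemma measurable_score (x : 𝓧) : Measurable (score ρ x) := by
  unfold score gradient
  exact (LinearIsometryEquiv.continuous _).measurable.comp (measurable_fderiv ℝ (ρ x))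

lemma continuous_toEuclideanCLM_symMatrix :
    Continuous fun z : NoiseIdx p → ℝ =>
      Matrix.toEuclideanCLM (𝕜 := ℝ) (symMatrix (z ∘ Sum.inr)) := by
  let l : (NoiseIdx p → ℝ) →ₗ[ℝ] (EuclideanSpace ℝ (Fin p) →L[ℝ] EuclideanSpace ℝ (Fin p)) :=
    { toFun := fun z => Matrix.toEuclideanCLM (𝕜 := ℝ) (symMatrix (z ∘ Sum.inr))
      map_add' := fun a b => by
        rw [← map_add]; rfl
      map_smul' := fun c a => by
        rw [RingHom.id_apply, ← map_smul]; rfl }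
  exact l.continuous_of_finiteDimensional

/-- Derivatives are measurable by `measurable_fderiv`, so no continuity in `θ` of the second
derivative is needed. -/
lemma measurable_newtonStep (B Bbar μ : ℝ) (K : ℕ) (x : Fin n → 𝓧) :
    Measurable (newtonStep ρ B Bbar μ K x).uncurry := by
  unfold newtonStep
  refine Measurable.sub measurable_fst ?_
  have hH : Measurable fun q : EuclideanSpace ℝ (Fin p) × (NoiseIdx p → ℝ) =>
      noisyHessian ρ Bbar μ K x q.1 (symMatrix (q.2 ∘ Sum.inr)) := by
    unfold noisyHessian
    refine Measurable.add (Measurable.fun_const_smul (Finset.measurable_fun_sum _ fun i _ =>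
      (measurable_fderiv ℝ (score ρ (x i))).comp measurable_fst) _) ?_
    exact (continuous_toEuclideanCLM_symMatrix.measurable.comp measurable_snd).fun_const_smul _
  have hg : Measurable fun q : EuclideanSpace ℝ (Fin p) × (NoiseIdx p → ℝ) =>
      noisyGradient ρ B μ K x q.1 (WithLp.toLp 2 (q.2 ∘ Sum.inl)) := by
    unfold noisyGradient
    refine Measurable.add (Measurable.fun_const_smul (Finset.measurable_fun_sum _ fun i _ =>
      (measurable_score ρ (x i)).comp measurable_fst) _) ?_
    refine Measurable.fun_const_smul ?_ _
    have : Continuous fun z : NoiseIdx p → ℝ => (WithLp.toLp 2 (z ∘ Sum.inl) :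
        EuclideanSpace ℝ (Fin p)) :=
      (PiLp.continuous_toLp 2 _).comp (by fun_prop)
    exact this.measurable.comp measurable_snd
  have hev : Continuous fun q : (EuclideanSpace ℝ (Fin p) →L[ℝ] EuclideanSpace ℝ (Fin p)) ×
      EuclideanSpace ℝ (Fin p) => q.1 q.2 := by fun_prop
  exact hev.measurable.comp ((measurable_clm_inverse.comp hH).prodMk hg)

end Measurability

lemma noiseBlock_eq_noiseEntry {Ω : Type*} {p K : ℕ} {Z : ℕ → Ω → EuclideanSpace ℝ (Fin p)}
    {W : ℕ → Ω → Matrix (Fin p) (Fin p) ℝ} {k : ℕ} (hk : k < K) (ω : Ω) :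
    noiseBlock Z W k ω = fun s => noiseEntry K Z W (⟨k, hk⟩, s) ω := by
  ext s
  rcases s with i | ij <;> rfl

section Law

variable {𝓧 Ω : Type*} [MeasurableSpace Ω] {p n K : ℕ} {P : Measure Ω}
  {Z : ℕ → Ω → EuclideanSpace ℝ (Fin p)} {W : ℕ → Ω → Matrix (Fin p) (Fin p) ℝ}

lemma IsNewtonNoise.hasLaw_noiseBlock (hN : IsNewtonNoise P K Z W) {k : ℕ} (hk : k < K) :
    HasLaw (noiseBlock Z W k) (gaussPi (NoiseIdx p)) P := by
  have h1 : iIndepFun (fun s : NoiseIdx p => noiseEntry K Z W (⟨k, hk⟩, s)) P :=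
    hN.indep.precomp (g := fun s : NoiseIdx p => ((⟨k, hk⟩ : Fin K), s))
      (Prod.mk_right_injective _)
  have h2 := h1.hasLaw_pi (μ := fun _ => gaussianReal 0 1) fun s => hN.law _
  have h3 : noiseBlock Z W k = fun ω s => noiseEntry K Z W (⟨k, hk⟩, s) ω :=
    funext fun ω => noiseBlock_eq_noiseEntry hk ω
  rw [h3]
  exact h2

variable (ρ : 𝓧 → EuclideanSpace ℝ (Fin p) → ℝ) (B Bbar μ : ℝ)
  (θinit : EuclideanSpace ℝ (Fin p)) (x : Fin n → 𝓧)

lemma noisyNewton_succ (hN : IsNewtonNoise P K Z W) {k : ℕ} (hk : k < K) (ω : Ω) :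
    noisyNewton ρ 1 B Bbar μ K θinit Z W x (k + 1) ω =
      newtonStep ρ B Bbar μ K x (noisyNewton ρ 1 B Bbar μ K θinit Z W x k ω)
        (noiseBlock Z W k ω) := by
  have h1 : symMatrix (noiseBlock Z W k ω ∘ Sum.inr) = W k ω :=
    symMatrix_of_isSymm (hN.symm k hk ω)
  have h2 : WithLp.toLp 2 (noiseBlock Z W k ω ∘ Sum.inl) = Z k ω := rfl
  rw [newtonStep, h1, h2]
  simp only [noisyNewton, one_smul]

/-- The indices of the noise variables of the first `k` iterations. -/
def pastIdx (K p k : ℕ) : Finset (Fin K × NoiseIdx p) :=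
  Finset.univ.filter fun s => s.1.val < k

/-- Writing the iterate as a measurable function of past entries yields both its measurability and
its independence of the current block of noise. -/
lemma exists_noisyNewton_eq (hN : IsNewtonNoise P K Z W) {k : ℕ} (hk : k ≤ K) :
    ∃ G : (pastIdx K p k → ℝ) → EuclideanSpace ℝ (Fin p), Measurable G ∧
      ∀ ω, noisyNewton ρ 1 B Bbar μ K θinit Z W x k ω =
        G (fun s => noiseEntry K Z W s.1 ω) := by
  induction k with
  | zero => exact ⟨fun _ => θinit, measurable_const, fun ω => rfl⟩
  | succ k ih =>
    obtain ⟨G, hG, hGe⟩ := ih (by omega)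
    have hsub : ∀ s : pastIdx K p k, s.1 ∈ pastIdx K p (k + 1) := fun s => by
      have := (Finset.mem_filter.1 s.2).2
      exact Finset.mem_filter.2 ⟨Finset.mem_univ _, by omega⟩
    have hnew : ∀ s : NoiseIdx p, ((⟨k, hk⟩ : Fin K), s) ∈ pastIdx K p (k + 1) := fun s =>
      Finset.mem_filter.2 ⟨Finset.mem_univ _, by simp⟩
    refine ⟨fun y => newtonStep ρ B Bbar μ K x (G fun s => y ⟨s.1, hsub s⟩)
      (fun s => y ⟨_, hnew s⟩), ?_, fun ω => ?_⟩
    · refine (measurable_newtonStep ρ B Bbar μ K x).comp (Measurable.prodMk (hG.comp ?_) ?_)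
      · exact measurable_pi_lambda _ fun s => measurable_pi_apply _
      · exact measurable_pi_lambda _ fun s => measurable_pi_apply _
    · rw [noisyNewton_succ ρ B Bbar μ θinit x hN hk, hGe, noiseBlock_eq_noiseEntry hk]

lemma aemeasurable_noisyNewton (hN : IsNewtonNoise P K Z W) {k : ℕ} (hk : k ≤ K) :
    AEMeasurable (noisyNewton ρ 1 B Bbar μ K θinit Z W x k) P := by
  obtain ⟨G, hG, hGe⟩ := exists_noisyNewton_eq ρ B Bbar μ θinit x hN hk
  rw [funext hGe]
  exact hG.comp_aemeasurable (aemeasurable_pi_lambda _ fun s => (hN.law s.1).aemeasurable)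

lemma indepFun_noisyNewton_noiseBlock (hN : IsNewtonNoise P K Z W) {k : ℕ} (hk : k < K) :
    IndepFun (noisyNewton ρ 1 B Bbar μ K θinit Z W x k) (noiseBlock Z W k) P := by
  obtain ⟨G, hG, hGe⟩ := exists_noisyNewton_eq ρ B Bbar μ θinit x hN hk.le
  let T : Finset (Fin K × NoiseIdx p) := Finset.univ.filter fun s => s.1.val = k
  have hd : Disjoint (pastIdx K p k) T := by
    rw [Finset.disjoint_left]
    intro s h1 h2
    have h1' := (Finset.mem_filter.1 h1).2
    have h2' := (Finset.mem_filter.1 h2).2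
    omega
  have h := hN.indep.indepFun_finset₀ _ T hd fun s => (hN.law s).aemeasurable
  have hT : ∀ s : NoiseIdx p, ((⟨k, hk⟩ : Fin K), s) ∈ T := fun s =>
    Finset.mem_filter.2 ⟨Finset.mem_univ _, rfl⟩
  have h2 := h.comp hG (ψ := fun y : T → ℝ => fun s : NoiseIdx p => y ⟨_, hT s⟩)
    (measurable_pi_lambda _ fun s => measurable_pi_apply _)
  have e1 : noisyNewton ρ 1 B Bbar μ K θinit Z W x k =
      G ∘ fun ω (s : pastIdx K p k) => noiseEntry K Z W s.1 ω := funext hGe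
  have e2 : noiseBlock Z W k = (fun y : T → ℝ => fun s : NoiseIdx p => y ⟨_, hT s⟩) ∘
      fun ω (s : T) => noiseEntry K Z W s.1 ω := funext fun ω => noiseBlock_eq_noiseEntry hk ω
  rw [e1, e2]
  exact h2

/-- Expectations of functions of the iterates are iterates of the transition operator. -/
lemma integral_noisyNewton [IsProbabilityMeasure P] (hN : IsNewtonNoise P K Z W) {k : ℕ}
    (hk : k ≤ K) {φ : EuclideanSpace ℝ (Fin p) → ℝ} (hφ : Measurable φ)
    (h01 : ∀ e, φ e ∈ Set.Icc (0 : ℝ) 1) :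
    ∫ ω, φ (noisyNewton ρ 1 B Bbar μ K θinit Z W x k ω) ∂P =
      (transition (newtonStep ρ B Bbar μ K x))^[k] φ θinit := by
  induction k generalizing φ with
  | zero => simp [noisyNewton]
  | succ k ih =>
    have hU := measurable_newtonStep ρ B Bbar μ K x
    -- Here the last update is split off: it is integrated out first, by independence, and the
    -- induction hypothesis is applied to the new test function `transition _ φ`.
    rw [Function.iterate_succ_apply, ← ih (by omega) (measurable_transition hU hφ)
      (transition_mem_Icc hU hφ h01)]
    have hk' : k < K := hk
    have hm := aemeasurable_noisyNewton ρ B Bbar μ θinit x hN hk'.le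
    set ν := P.map (noisyNewton ρ 1 B Bbar μ K θinit Z W x k) with hν
    have hlaw : HasLaw (noisyNewton ρ 1 B Bbar μ K θinit Z W x k) ν P := ⟨hm, rfl⟩
    have : IsProbabilityMeasure ν := Measure.isProbabilityMeasure_map hm
    have hprod := (indepFun_noisyNewton_noiseBlock ρ B Bbar μ θinit x hN hk').hasLaw_prod hlaw
      (hN.hasLaw_noiseBlock hk')
    simp only [noisyNewton_succ ρ B Bbar μ θinit x hN hk']
    have hm2 : Measurable fun q : EuclideanSpace ℝ (Fin p) × (NoiseIdx p → ℝ) =>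
      φ (newtonStep ρ B Bbar μ K x q.1 q.2) := hφ.comp hU
    have e1 := hprod.integral_comp (f := fun q => φ (newtonStep ρ B Bbar μ K x q.1 q.2))
      hm2.aestronglyMeasurable
    simp only [Function.comp_def] at e1
    rw [e1, integral_prod]
    · have e2 := hlaw.integral_comp (f := transition (newtonStep ρ B Bbar μ K x) φ)
        (measurable_transition hU hφ).aestronglyMeasurable
      simp only [Function.comp_def] at e2
      rw [e2]
      rfl
    · refine Integrable.of_bound (C := 1) hm2.aestronglyMeasurable
        (Filter.Eventually.of_forall fun q => ?_)
      rw [norm_of_nonneg (h01 _).1]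
      exact (h01 _).2

end Law

/-! ### Sensitivity and privacy -/

/-- Replacing one entry of a data set changes a sum over the data set by one difference. -/
lemma Neighbours.exists_sum_sub {𝓧 E : Type*} [AddCommGroup E] {n : ℕ} {x x' : Fin n → 𝓧}
    (h : Neighbours x x') :
    ∃ j, ∀ f : 𝓧 → E, ∑ i, f (x' i) - ∑ i, f (x i) = f (x' j) - f (x j) := by
  obtain ⟨j, hj⟩ := Set.ncard_eq_one.1 h
  refine ⟨j, fun f => ?_⟩
  rw [← Finset.sum_sub_distrib]
  refine Finset.sum_eq_single j (fun i _ hij => ?_) (by simp)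
  have : i ∉ {i | x i ≠ x' i} := by rw [hj]; exact hij
  rw [Set.mem_ofPred_eq, not_not] at this
  rw [this, sub_self]

section Sensitivity

variable {p : ℕ}

/-- The change of the Hessian is symmetric, hence reachable by shifting only the free
upper-triangular noise entries. -/
lemma toEuclideanCLM_symMatrix_rankOne (c : ℝ) (a b : EuclideanSpace ℝ (Fin p)) :
    Matrix.toEuclideanCLM (𝕜 := ℝ) (symMatrix fun ij =>
        c * (b ij.1.1 * b ij.1.2 - a ij.1.1 * a ij.1.2)) =
      c • (InnerProductSpace.rankOne ℝ b b - InnerProductSpace.rankOne ℝ a a) := by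
  have hs : symMatrix (fun ij => c * (b ij.1.1 * b ij.1.2 - a ij.1.1 * a ij.1.2)) =
      Matrix.of fun i j => c * (b i * b j - a i * a j) := by
    refine symMatrix_of_isSymm (M := Matrix.of fun i j => c * (b i * b j - a i * a j)) ?_
    ext i j
    simp only [Matrix.transpose_apply, Matrix.of_apply]
    ring
  rw [hs]
  ext v i
  simp only [Matrix.ofLp_toEuclideanCLM, Matrix.mulVec, dotProduct, Matrix.of_apply,
    _root_.smul_apply, _root_.sub_apply, InnerProductSpace.rankOne_apply,
    PiLp.smul_apply, PiLp.sub_apply, smul_eq_mul, PiLp.inner_apply, RCLike.inner_apply,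
    conj_trivial]
  rw [Finset.sum_mul, Finset.sum_mul, ← Finset.sum_sub_distrib, Finset.mul_sum]
  exact Finset.sum_congr rfl fun j _ => by ring

/-- The upper triangle is bounded by the full Frobenius norm, in whose expansion the cross term
`-2⟨a, b⟩²` has the favourable sign. -/
lemma sum_sq_upper_rankOne_sub_le (a b : EuclideanSpace ℝ (Fin p)) :
    ∑ ij : {ij : Fin p × Fin p // ij.1 ≤ ij.2},
        (b ij.1.1 * b ij.1.2 - a ij.1.1 * a ij.1.2) ^ 2 ≤ (‖a‖ ^ 2) ^ 2 + (‖b‖ ^ 2) ^ 2 := by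
  calc ∑ ij : {ij : Fin p × Fin p // ij.1 ≤ ij.2},
        (b ij.1.1 * b ij.1.2 - a ij.1.1 * a ij.1.2) ^ 2
      ≤ ∑ ij : Fin p × Fin p, (b ij.1 * b ij.2 - a ij.1 * a ij.2) ^ 2 := by
        rw [← Finset.sum_subtype (Finset.univ.filter fun ij : Fin p × Fin p => ij.1 ≤ ij.2)
          (by simp) (fun ij => (b ij.1 * b ij.2 - a ij.1 * a ij.2) ^ 2)]
        exact Finset.sum_le_sum_of_subset_of_nonneg (Finset.filter_subset _ _)
          fun _ _ _ => sq_nonneg _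
    _ = (∑ i, b i ^ 2) ^ 2 - 2 * (∑ i, a i * b i) ^ 2 + (∑ i, a i ^ 2) ^ 2 := by
        rw [Fintype.sum_prod_type, sq (∑ i, b i ^ 2), sq (∑ i, a i * b i), sq (∑ i, a i ^ 2),
          Finset.sum_mul_sum, Finset.sum_mul_sum, Finset.sum_mul_sum, Finset.mul_sum,
          ← Finset.sum_sub_distrib, ← Finset.sum_add_distrib]
        refine Finset.sum_congr rfl fun i _ => ?_
        rw [Finset.mul_sum, ← Finset.sum_sub_distrib, ← Finset.sum_add_distrib]
        exact Finset.sum_congr rfl fun j _ => by ring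
    _ ≤ _ := by
        rw [EuclideanSpace.norm_sq_eq, EuclideanSpace.norm_sq_eq]
        simp only [norm_eq_abs, sq_abs]
        nlinarith [sq_nonneg (∑ i, a i * b i)]

variable {𝓧 : Type*} {n K : ℕ} {ρ : 𝓧 → EuclideanSpace ℝ (Fin p) → ℝ} {B Bbar μ : ℝ}

/-- Replacing one entry of the data set has the same effect on a noisy Newton update as a
translation of its noise. -/
lemma exists_newtonStep_translate (hn : 0 < n) (hK : 0 < K) (hμ : 0 < μ) (hB : 0 < B)
    (hBbar : 0 < Bbar) (hd : ∀ x, Differentiable ℝ (ρ x))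
    (hd2 : ∀ x, Differentiable ℝ (score ρ x)) (hs : ∀ x θ, ‖score ρ x θ‖ ≤ B)
    (hG : GramHessian n ρ Bbar) {x x' : Fin n → 𝓧} (hx : Neighbours x x')
    (θ : EuclideanSpace ℝ (Fin p)) :
    ∃ v : NoiseIdx p → ℝ, ∑ s, v s ^ 2 ≤ μ ^ 2 / K ∧
      ∀ z, newtonStep ρ B Bbar μ K x' θ z = newtonStep ρ B Bbar μ K x θ (z + v) := by
  obtain ⟨a, ha, hGa⟩ := hG
  have hn0 : (0 : ℝ) < n := Nat.cast_pos.2 hn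
  have hK0 : (0 : ℝ) < K := Nat.cast_pos.2 hK
  have hsq : (√(2 * K)) ^ 2 = 2 * (K : ℝ) := sq_sqrt (by positivity)
  have hsqpos : 0 < √(2 * (K : ℝ)) := sqrt_pos.2 (by positivity)
  set σg := 2 * B * √(2 * K) / (μ * n) with hσg
  set σH := 2 * Bbar * √(2 * K) / (μ * n) with hσH
  have hσg0 : 0 < σg := by positivity
  have hσH0 : 0 < σH := by positivity
  obtain ⟨j, hj⟩ := hx.exists_sum_sub (E := EuclideanSpace ℝ (Fin p))
  -- The differing index is extracted once for vectors and once for operators; that `j = j'` is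
  -- never needed.
  obtain ⟨j', hj'⟩ := hx.exists_sum_sub
    (E := EuclideanSpace ℝ (Fin p) →L[ℝ] EuclideanSpace ℝ (Fin p))
  set d := score ρ (x' j) θ - score ρ (x j) θ with hd'
  set b₁ := a (x j') θ
  set b₂ := a (x' j') θ
  have hdn : ‖d‖ ≤ 2 * B := (norm_sub_le _ _).trans (by linarith [hs (x' j) θ, hs (x j) θ])
  have hHdiff : (n : ℝ)⁻¹ • ∑ i, scoreDeriv ρ (x' i) θ =
      (n : ℝ)⁻¹ • ∑ i, scoreDeriv ρ (x i) θ + (n : ℝ)⁻¹ •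
        (InnerProductSpace.rankOne ℝ b₂ b₂ - InnerProductSpace.rankOne ℝ b₁ b₁) := by
    rw [← hessian_empRisk hd hd2, ← hessian_empRisk hd hd2, hGa, hGa,
      sub_eq_iff_eq_add'.1 (hj' fun y => InnerProductSpace.rankOne ℝ (a y θ) (a y θ))]
    exact smul_add _ _ _
  have hgdiff : (n : ℝ)⁻¹ • ∑ i, score ρ (x' i) θ =
      (n : ℝ)⁻¹ • ∑ i, score ρ (x i) θ + (n : ℝ)⁻¹ • d := by
    rw [← smul_add, hd', ← hj fun y => score ρ y θ]
    congr 1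
    abel
  -- The translation is the change of the averaged score and Hessian, measured in units of the noise
  -- scales `σg` and `σH`.
  refine ⟨Sum.elim (fun i => (n * σg)⁻¹ * d i)
    (fun ij => (n * σH)⁻¹ * (b₂ ij.1.1 * b₂ ij.1.2 - b₁ ij.1.1 * b₁ ij.1.2)), ?_, fun z => ?_⟩
  · rw [Fintype.sum_sum_type]
    simp only [Sum.elim_inl, Sum.elim_inr, mul_pow]
    rw [← Finset.mul_sum, ← Finset.mul_sum]
    have h1 : ∑ i, d i ^ 2 ≤ (2 * B) ^ 2 := by
      have := EuclideanSpace.norm_sq_eq d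
      simp only [norm_eq_abs, sq_abs] at this
      rw [← this]
      gcongr
    have h2 := sum_sq_upper_rankOne_sub_le b₁ b₂
    have h3 : (‖b₁‖ ^ 2) ^ 2 + (‖b₂‖ ^ 2) ^ 2 ≤ (2 * Bbar) ^ 2 := by
      have e1 : (‖b₁‖ ^ 2) ^ 2 ≤ Bbar ^ 2 := by gcongr; exact ha _ _
      have e2 : (‖b₂‖ ^ 2) ^ 2 ≤ Bbar ^ 2 := by gcongr; exact ha _ _
      nlinarith
    -- The factor `√(2 * K)` in the noise splits the budget `μ ^ 2 / K` of one iteration equally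
    -- between gradient and Hessian.
    have e1 : ((n * σg)⁻¹) ^ 2 * (2 * B) ^ 2 = μ ^ 2 / (2 * K) := by
      rw [← hsq, hσg]; field_simp
    have e2 : ((n * σH)⁻¹) ^ 2 * (2 * Bbar) ^ 2 = μ ^ 2 / (2 * K) := by
      rw [← hsq, hσH]; field_simp
    calc _ ≤ ((n * σg)⁻¹) ^ 2 * (2 * B) ^ 2 + ((n * σH)⁻¹) ^ 2 * (2 * Bbar) ^ 2 := by
          gcongr
          exact h2.trans h3
      _ = μ ^ 2 / K := by rw [e1, e2]; field_simp; ring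
  · have hg : noisyGradient ρ B μ K x' θ (WithLp.toLp 2 (z ∘ Sum.inl)) =
        noisyGradient ρ B μ K x θ (WithLp.toLp 2 ((z + Sum.elim (fun i => (n * σg)⁻¹ * d i)
          (fun ij => (n * σH)⁻¹ * (b₂ ij.1.1 * b₂ ij.1.2 - b₁ ij.1.1 * b₁ ij.1.2)))
            ∘ Sum.inl)) := by
      rw [noisyGradient, noisyGradient, hgdiff, add_assoc]
      congr 1
      ext i
      simp only [PiLp.add_apply, PiLp.smul_apply, smul_eq_mul, Function.comp_apply, Pi.add_apply,
        Sum.elim_inl]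
      rw [← hσg]
      field_simp
      ring
    have hH : noisyHessian ρ Bbar μ K x' θ (symMatrix (z ∘ Sum.inr)) =
        noisyHessian ρ Bbar μ K x θ (symMatrix ((z + Sum.elim (fun i => (n * σg)⁻¹ * d i)
          (fun ij => (n * σH)⁻¹ * (b₂ ij.1.1 * b₂ ij.1.2 - b₁ ij.1.1 * b₁ ij.1.2)))
            ∘ Sum.inr)) := by
      have e : (z + Sum.elim (fun i => (n * σg)⁻¹ * d i)
          (fun ij => (n * σH)⁻¹ * (b₂ ij.1.1 * b₂ ij.1.2 - b₁ ij.1.1 * b₁ ij.1.2))) ∘ Sum.inr =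
          z ∘ Sum.inr + fun ij : {ij : Fin p × Fin p // ij.1 ≤ ij.2} =>
            (n * σH)⁻¹ * (b₂ ij.1.1 * b₂ ij.1.2 - b₁ ij.1.1 * b₁ ij.1.2) := rfl
      rw [noisyHessian, noisyHessian, hHdiff, e, symMatrix_add, map_add,
        toEuclideanCLM_symMatrix_rankOne, smul_add, smul_smul, add_assoc]
      congr 1
      rw [add_comm]
      congr 2
      rw [← hσH]
      field_simp
    rw [newtonStep, newtonStep, hg, hH]

/-- The noisy Newton iterate is Gaussian differentially private. -/
theorem isGDP_noisyNewton {Ω : Type*} [MeasurableSpace Ω] {P : Measure Ω} [IsProbabilityMeasure P]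
    {Z : ℕ → Ω → EuclideanSpace ℝ (Fin p)} {W : ℕ → Ω → Matrix (Fin p) (Fin p) ℝ}
    (hN : IsNewtonNoise P K Z W) (hn : 0 < n) (hK : 0 < K) (hμ : 0 < μ) (hB : 0 < B)
    (hBbar : 0 < Bbar) (hd : ∀ x, Differentiable ℝ (ρ x))
    (hd2 : ∀ x, Differentiable ℝ (score ρ x)) (hs : ∀ x θ, ‖score ρ x θ‖ ≤ B)
    (hG : GramHessian n ρ Bbar) (θinit : EuclideanSpace ℝ (Fin p)) :
    IsGDP μ P fun x : Fin n → 𝓧 => noisyNewton ρ 1 B Bbar μ K θinit Z W x K := by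
  refine ⟨fun x => aemeasurable_noisyNewton ρ B Bbar μ θinit x hN le_rfl,
    fun x x' hx φ hφ h01 α hα hle => ?_⟩
  choose v hv hstep using
    exists_newtonStep_translate hn hK hμ hB hBbar hd hd2 hs hG hx
  have hK0 : (K : ℝ≥0) ≠ 0 := Nat.cast_ne_zero.2 hK.ne'
  have ht : ((‖μ‖₊ ^ 2 / K : ℝ≥0) : ℝ) = μ ^ 2 / K := by simp
  have key := iterate_transition_le (measurable_newtonStep ρ B Bbar μ K x)
    (measurable_newtonStep ρ B Bbar μ K x') v (‖μ‖₊ ^ 2 / K)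
    (fun θ => by rw [ht]; exact hv θ) hstep hφ h01 K
  rw [mul_div_cancel₀ _ hK0] at key
  simp only [integral_noisyNewton ρ B Bbar μ θinit _ hN le_rfl hφ h01] at hle ⊢
  obtain ⟨-, hm⟩ := iterate_transition_mem_Icc (measurable_newtonStep ρ B Bbar μ K x) hφ h01 K
  obtain ⟨-, hm'⟩ := iterate_transition_mem_Icc (measurable_newtonStep ρ B Bbar μ K x') hφ h01 K
  exact le_one_sub_gaussianTradeoff hμ (hm θinit).1 (hm' θinit).2 (fun ε => key ε θinit) hle

end Sensitivity

/-! ### Deterministic analysis of the perturbed Newton iteration -/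

section Deterministic

variable {E : Type*} [NormedAddCommGroup E] [InnerProductSpace ℝ E]

/-- The restriction of a vector field to a line, tested against the direction of the line. -/
lemma hasDerivAt_inner_line {g : E → E} {H : E → E →L[ℝ] E} (hg : ∀ θ, HasFDerivAt g (H θ) θ)
    (θ v : E) (t : ℝ) :
    HasDerivAt (fun t : ℝ => inner ℝ v (g (θ + t • v))) (inner ℝ v (H (θ + t • v) v)) t := by
  have h1 : HasDerivAt (fun t : ℝ => θ + t • v) v t := by
    simpa using ((hasDerivAt_id t).smul_const v).const_add θ
  have h2 : HasDerivAt (fun t : ℝ => g (θ + t • v)) (H (θ + t • v) v) t :=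
    (hg _).comp_hasDerivAt t h1
  exact (innerSL ℝ v).hasFDerivAt.comp_hasDerivAt t h2

/-- A strongly monotone differentiable vector field with continuous derivative on a closed ball has
a coercive derivative there. -/
lemma coercive_of_strongMono {g : E → E} {H : E → E →L[ℝ] E}
    (hg : ∀ θ, HasFDerivAt g (H θ) θ) (hH : Continuous H) {θ₀ : E} {r m : ℝ} (hr : 0 < r)
    (hmono : ∀ θ₁ ∈ Metric.closedBall θ₀ r, ∀ θ₂ ∈ Metric.closedBall θ₀ r,
      m * ‖θ₁ - θ₂‖ ^ 2 ≤ inner ℝ (θ₁ - θ₂) (g θ₁ - g θ₂))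
    {θ : E} (hθ : θ ∈ Metric.closedBall θ₀ r) (v : E) : m * ‖v‖ ^ 2 ≤ inner ℝ v (H θ v) := by
  -- Interior points come first, where difference quotients in every direction stay in the ball;
  -- continuity of `H` then extends the bound to the boundary.
  have hopen : ∀ θ ∈ Metric.ball θ₀ r, m * ‖v‖ ^ 2 ≤ inner ℝ v (H θ v) := by
    intro θ hθ
    have h1 := hasDerivAt_inner_line hg θ v 0
    rw [zero_smul, add_zero] at h1
    refine ge_of_tendsto h1.tendsto_slope_zero_right ?_
    have hc : Filter.Tendsto (fun t : ℝ => θ + t • v) (nhdsWithin 0 (Set.Ioi 0)) (nhds θ) := by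
      have : Continuous fun t : ℝ => θ + t • v := by fun_prop
      have := this.tendsto 0
      simp only [zero_smul, add_zero] at this
      exact this.mono_left nhdsWithin_le_nhds
    filter_upwards [hc.eventually (Metric.isOpen_ball.mem_nhds hθ), self_mem_nhdsWithin]
      with t ht ht0
    have ht0 : 0 < t := ht0
    have h2 := hmono _ (Metric.ball_subset_closedBall ht) _ (Metric.ball_subset_closedBall hθ)
    rw [add_sub_cancel_left, norm_smul, norm_of_nonneg ht0.le, real_inner_smul_left, mul_pow,
      inner_sub_right] at h2
    simp only [zero_add, smul_eq_mul, zero_smul, add_zero]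
    rw [le_inv_mul_iff₀ ht0]
    have h3 : t * (t * (m * ‖v‖ ^ 2)) ≤
        t * (inner ℝ v (g (θ + t • v)) - inner ℝ v (g θ)) := by
      linarith
    exact le_of_mul_le_mul_left h3 ht0
  have hcl : IsClosed {θ | m * ‖v‖ ^ 2 ≤ inner ℝ v (H θ v)} :=
    isClosed_le continuous_const (by fun_prop)
  rw [← closure_ball θ₀ hr.ne'] at hθ
  exact hcl.closure_subset_iff.2 hopen hθ

/-- A monotone vector field that is small at a point and strongly monotone near its zero has its
zero close to the point. -/
lemma norm_sub_le_of_norm_le {g : E → E} {H : E → E →L[ℝ] E}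
    (hg : ∀ θ, HasFDerivAt g (H θ) θ) (hpos : ∀ θ v, 0 ≤ inner ℝ v (H θ v))
    {θhat : E} (h0 : g θhat = 0) {s m : ℝ} (hs : 0 < s) (hm : 0 < m)
    (hco : ∀ θ ∈ Metric.closedBall θhat s, ∀ v, m * ‖v‖ ^ 2 ≤ inner ℝ v (H θ v))
    {θ : E} (hθ : ‖g θ‖ ≤ m * s) : ‖θ - θhat‖ ≤ s := by
  by_contra hD
  rw [not_le] at hD
  set D := ‖θ - θhat‖ with hDdef
  have hD0 : 0 < D := hs.trans hD
  set u := D⁻¹ • (θ - θhat) with hu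
  have hun : ‖u‖ = 1 := by
    rw [hu, norm_smul, norm_inv, norm_of_nonneg hD0.le, ← hDdef, inv_mul_cancel₀ hD0.ne']
  -- The radial component of `g` on the ray from `θhat` through `θ`: it grows at rate at least `m`
  -- up to `s` and is monotone beyond.
  set φ : ℝ → ℝ := fun t => inner ℝ u (g (θhat + t • u)) with hφ
  have hder : ∀ t, HasDerivAt φ (inner ℝ u (H (θhat + t • u) u)) t :=
    fun t => hasDerivAt_inner_line hg θhat u t
  have hmono : Monotone φ := monotone_of_hasDerivAt_nonneg hder fun t => hpos _ _
  have hball : ∀ t ∈ Set.Icc 0 s, θhat + t • u ∈ Metric.closedBall θhat s := by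
    intro t ht
    rw [mem_closedBall_iff_norm, add_sub_cancel_left, norm_smul, hun, mul_one,
      norm_of_nonneg ht.1]
    exact ht.2
  have hlow : m * s ≤ φ s := by
    have h1 := (convex_Icc 0 s).mul_sub_le_image_sub_of_le_deriv (f := φ) (C := m)
      (fun t _ => (hder t).continuousAt.continuousWithinAt)
      (fun t _ => (hder t).differentiableAt.differentiableWithinAt) (fun t ht => by
        rw [interior_Icc] at ht
        rw [(hder t).deriv]
        have := hco _ (hball t ⟨ht.1.le, ht.2.le⟩) u
        rwa [hun, one_pow, mul_one] at this) 0 ⟨le_rfl, hs.le⟩ s ⟨hs.le, le_rfl⟩ hs.le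
    have h2 : φ 0 = 0 := by simp [hφ, h0]
    rw [h2] at h1
    linarith
  have hup : φ D ≤ m * s := by
    have h1 : θhat + D • u = θ := by
      rw [hu, smul_smul, mul_inv_cancel₀ hD0.ne', one_smul]; abel
    have h2 := real_inner_le_norm u (g θ)
    rw [hun, one_mul] at h2
    simp only [hφ, h1]
    exact h2.trans hθ
  -- As `‖g θ‖ = m * s` is allowed, values alone give no contradiction: they force `φ` to be
  -- constant on `(s, D)`, against its derivative at `s` being at least `m`.
  have hconst : ∀ t ∈ Set.Ioo s D, φ t = φ s := fun t ht =>
    le_antisymm (((hmono ht.2.le).trans hup).trans hlow) (hmono ht.1.le)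
  have hlim := (hder s).tendsto_slope_zero_right
  have hzero : Filter.Tendsto (fun t : ℝ => t⁻¹ • (φ (s + t) - φ s)) (nhdsWithin 0 (Set.Ioi 0))
      (nhds 0) := by
    refine tendsto_const_nhds.congr' ?_
    filter_upwards [Ioo_mem_nhdsGT (show (0 : ℝ) < D - s by linarith)] with t ht
    rw [hconst (s + t) ⟨by linarith [ht.1], by linarith [ht.2]⟩, sub_self, smul_zero]
  have h3 := tendsto_nhds_unique hlim hzero
  have h4 := hco _ (hball s ⟨hs.le, le_rfl⟩) u
  rw [h3, hun] at h4
  linarith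

/-- The error of the first-order expansion of a vector field with Lipschitz derivative. -/
lemma norm_sub_sub_le_of_lipschitz {g : E → E} {H : E → E →L[ℝ] E} {L : ℝ} (hL : 0 ≤ L)
    (hg : ∀ θ, HasFDerivAt g (H θ) θ) (hH : ∀ θ₁ θ₂, ‖H θ₁ - H θ₂‖ ≤ L * ‖θ₁ - θ₂‖) (θ θ' : E) :
    ‖g θ' - g θ - H θ (θ' - θ)‖ ≤ L * ‖θ' - θ‖ ^ 2 := by
  -- The mean value inequality gives the constant `L` instead of the sharp `L / 2`; this suffices.
  have h := (convex_closedBall θ ‖θ' - θ‖).norm_image_sub_le_of_norm_hasFDerivWithin_le'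
    (f := g) (f' := H) (φ := H θ) (C := L * ‖θ' - θ‖) (x := θ) (y := θ')
    (fun y _ => (hg y).hasFDerivWithinAt) (fun y hy => (hH y θ).trans (by
      rw [mem_closedBall_iff_norm] at hy; gcongr))
    (Metric.mem_closedBall_self (norm_nonneg _)) (by rw [mem_closedBall_iff_norm])
  rw [sq, ← mul_assoc]
  exact h

/-- A coercive operator on a finite-dimensional space is invertible, with a bound on its inverse. -/
lemma inverse_of_coercive [FiniteDimensional ℝ E] {A : E →L[ℝ] E} {m : ℝ} (hm : 0 < m)
    (hA : ∀ v, m * ‖v‖ ^ 2 ≤ inner ℝ v (A v)) :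
    (∀ v, A.inverse (A v) = v) ∧ ∀ w, ‖A.inverse w‖ ≤ m⁻¹ * ‖w‖ := by
  have hb : ∀ v, m * ‖v‖ ≤ ‖A v‖ := by
    intro v
    rcases (norm_nonneg v).eq_or_lt with h | h
    · rw [← h, mul_zero]; exact norm_nonneg _
    · have h1 := (hA v).trans (real_inner_le_norm v (A v))
      have h2 : ‖v‖ * (m * ‖v‖) ≤ ‖v‖ * ‖A v‖ := by linarith
      exact le_of_mul_le_mul_left h2 h
  have hinj : Function.Injective A := by
    rw [injective_iff_map_eq_zero]
    intro v hv
    have := hb v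
    rw [hv, norm_zero] at this
    have h2 : ‖v‖ ≤ 0 := by
      by_contra h
      have := mul_pos hm (not_le.1 h)
      linarith
    exact norm_le_zero_iff.1 h2
  let e := (LinearEquiv.ofInjectiveEndo A.toLinearMap hinj).toContinuousLinearEquiv
  have he : A = (e : E →L[ℝ] E) := by ext v; rfl
  have hinv : ∀ v, A.inverse (A v) = v := by
    intro v
    rw [he, ContinuousLinearMap.inverse_equiv]
    exact e.symm_apply_apply v
  refine ⟨hinv, fun w => ?_⟩
  obtain ⟨v, rfl⟩ : ∃ v, A v = w := ⟨e.symm w, by rw [he]; exact e.apply_symm_apply w⟩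
  rw [hinv, ← div_eq_inv_mul, le_div_iff₀ hm, mul_comm]
  exact hb v

/-- The error of one perturbed Newton step. -/
lemma norm_newton_step_sub_le [FiniteDimensional ℝ E] {g : E → E} {H : E → E →L[ℝ] E}
    {L τ : ℝ} (hL : 0 ≤ L) (hτ : 0 < τ) (hg : ∀ θ, HasFDerivAt g (H θ) θ)
    (hH : ∀ θ₁ θ₂, ‖H θ₁ - H θ₂‖ ≤ L * ‖θ₁ - θ₂‖) {θhat θ : E} (h0 : g θhat = 0)
    (hco : ∀ v, 2 * τ * ‖v‖ ^ 2 ≤ inner ℝ v (H θ v)) {M : E →L[ℝ] E} {N : E} {εH εg : ℝ}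
    (hM : ‖M‖ ≤ εH) (hN : ‖N‖ ≤ εg) (hεH : εH ≤ τ / 2) :
    ‖θ - (H θ + M).inverse (g θ + N) - θhat‖ ≤
      2 / (3 * τ) * (L * ‖θ - θhat‖ ^ 2 + εH * ‖θ - θhat‖ + εg) := by
  -- The perturbation costs at most `τ / 2` of the coercivity constant `2 * τ`.
  have hA : ∀ v, 3 * τ / 2 * ‖v‖ ^ 2 ≤ inner ℝ v ((H θ + M) v) := by
    intro v
    have h1 : -(εH * ‖v‖ ^ 2) ≤ inner ℝ v (M v) := by
      have h2 := (abs_le.1 (abs_real_inner_le_norm v (M v))).1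
      have h3 : ‖v‖ * ‖M v‖ ≤ ‖v‖ * (εH * ‖v‖) := by
        gcongr
        exact M.le_of_opNorm_le hM v
      linarith
    have h4 : εH * ‖v‖ ^ 2 ≤ τ / 2 * ‖v‖ ^ 2 := by gcongr
    rw [_root_.add_apply, inner_add_right]
    linarith [hco v]
  obtain ⟨hinv, hbd⟩ := inverse_of_coercive (by positivity) hA
  -- With `g θhat = 0`, the new error is the inverse applied to a Taylor remainder, the Hessian
  -- noise acting on the old error, and the gradient noise.
  have e1 : θ - (H θ + M).inverse (g θ + N) - θhat =
      (H θ + M).inverse ((g θhat - g θ - H θ (θhat - θ)) + M (θ - θhat) - N) := by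
    have : (g θhat - g θ - H θ (θhat - θ)) + M (θ - θhat) - N =
        (H θ + M) (θ - θhat) - (g θ + N) := by
      rw [h0, _root_.add_apply, ← neg_sub θ θhat, map_neg]
      abel
    rw [this, map_sub, hinv]
    abel
  rw [e1]
  refine (hbd _).trans ?_
  have e2 : (3 * τ / 2)⁻¹ = 2 / (3 * τ) := by rw [inv_div]
  rw [e2]
  gcongr
  refine (norm_sub_le _ _).trans (add_le_add ((norm_add_le _ _).trans (add_le_add ?_ ?_)) hN)
  · have := norm_sub_sub_le_of_lipschitz hL hg hH θ θhat
    rwa [norm_sub_rev θhat θ] at this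
  · exact M.le_of_opNorm_le hM _

end Deterministic

/-- Quadratic convergence up to a small perturbation. -/
lemma quadratic_recursion {q : ℕ → ℝ} {b : ℝ} {K : ℕ} (hb0 : 0 ≤ b) (hb : b ≤ 1 / 48)
    (hq : ∀ k ≤ K, 0 ≤ q k) (h0 : q 0 ≤ 1 / 3) (hrec : ∀ k < K, q (k + 1) ≤ q k ^ 2 + b) :
    q K ≤ 4 * b + (1 / 3) ^ 2 ^ K := by
  suffices h : ∀ k ≤ K, q k ≤ 4 * b + (1 / 3) ^ 2 ^ k from h K le_rfl
  intro k
  induction k with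
  | zero => intro _; simp only [pow_zero, pow_one]; linarith
  | succ k ih =>
    intro hk
    have h1 := ih (by omega)
    have h2 := hrec k (by omega)
    have h3 := hq k (by omega)
    have e : ((1 : ℝ) / 3) ^ 2 ^ (k + 1) = ((1 / 3) ^ 2 ^ k) ^ 2 := by
      rw [← pow_mul, pow_succ]
    set t : ℝ := (1 / 3) ^ 2 ^ k
    have ht0 : 0 ≤ t := by positivity
    have ht1 : t ≤ 1 / 3 := by
      have : ((1 : ℝ) / 3) ^ 2 ^ k ≤ (1 / 3) ^ 1 :=
        pow_le_pow_of_le_one (by norm_num) (by norm_num) Nat.one_le_two_pow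
      rwa [pow_one] at this
    have h4 : q k ^ 2 ≤ (4 * b + t) ^ 2 := by gcongr
    rw [e]
    -- The thresholds are tight here: `16 b² ≤ b / 3` and `8 b t ≤ 8 b / 3`, so `(4 b + t)² + b ≤ 4
    -- b + t²`.
    nlinarith [mul_nonneg hb0 (sub_nonneg.2 ht1), mul_nonneg hb0 (sub_nonneg.2 hb)]

/-- The perturbed Newton recursion stays in the region of convergence and converges
quadratically up to the size of the perturbation. -/
lemma newton_recursion {e : ℕ → ℝ} {K : ℕ} {L τ r εH εg : ℝ} (hL : 0 < L) (hτ : 0 < τ)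
    (he : ∀ k, 0 ≤ e k) (hr : e 0 ≤ r / 2) (hτL : e 0 ≤ τ / (2 * L)) (hεH0 : 0 ≤ εH)
    (hεg0 : 0 ≤ εg) (hεH : εH ≤ τ / 2) (hεg : εg ≤ τ / 2 * min (r / 2) (τ / (2 * L)))
    (hb : 4 * L / (9 * τ ^ 2) * (εH * (τ / (2 * L)) + εg) ≤ 1 / 48)
    (hrec : ∀ k < K, e k ≤ r / 2 →
      e (k + 1) ≤ 2 / (3 * τ) * (L * e k ^ 2 + εH * e k + εg)) :
    e K ≤ 3 * τ / (2 * L) *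
      (4 * (4 * L / (9 * τ ^ 2) * (εH * (τ / (2 * L)) + εg)) + (1 / 3) ^ 2 ^ K) := by
  set R := min (r / 2) (τ / (2 * L)) with hR
  have hR0 : 0 ≤ R := (he 0).trans (le_min hr hτL)
  have hRL : R * (2 * L) ≤ τ := by
    rw [← le_div_iff₀ (by positivity)]; exact min_le_right _ _
  -- Each of the three error terms is at most `τ / 2 * R`, and the prefactor `2 / (3 * τ)` turns
  -- their sum into `R`.
  have hstay : ∀ k ≤ K, e k ≤ R := by
    intro k
    induction k with
    | zero => intro _; exact le_min hr hτL
    | succ k ih =>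
      intro hk
      have h1 := ih (by omega)
      refine (hrec k (by omega) (h1.trans (min_le_left _ _))).trans ?_
      rw [div_mul_eq_mul_div, div_le_iff₀ (by positivity)]
      have h2 : L * e k ^ 2 ≤ L * (R * R) := by rw [sq]; have := he k; gcongr
      have h3 : εH * e k ≤ τ / 2 * R := by gcongr; exact he k
      nlinarith
  set b := 4 * L / (9 * τ ^ 2) * (εH * (τ / (2 * L)) + εg) with hbdef
  -- Rescaling by `c` makes the quadratic coefficient `1` and the initial value at most `1 / 3`.
  set c := 2 * L / (3 * τ) with hc
  have hc0 : 0 < c := by positivity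
  have key := quadratic_recursion (q := fun k => c * e k) (b := b) (K := K) (by positivity) hb
    (fun k _ => mul_nonneg hc0.le (he k)) (by
      calc c * e 0 ≤ c * (τ / (2 * L)) := by gcongr
        _ = 1 / 3 := by rw [hc]; field_simp)
    (fun k hk => by
      have h1 := hstay k hk.le
      calc c * e (k + 1) ≤ c * (2 / (3 * τ) * (L * e k ^ 2 + εH * (τ / (2 * L)) + εg)) := by
            refine mul_le_mul_of_nonneg_left ((hrec k hk (h1.trans (min_le_left _ _))).trans ?_)
              hc0.le
            have := h1.trans (min_le_right _ _)
            gcongr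
        _ = (c * e k) ^ 2 + b := by rw [hc, hbdef]; field_simp; ring)
  have e1 : e K = 3 * τ / (2 * L) * (c * e K) := by rw [hc]; field_simp
  rw [e1]
  gcongr

/-! ### Tail bounds for the Gaussian noise -/

/-- The quadratic form of a symmetric operator is large on a ball of fixed radius. -/
lemma exists_ball_quadratic_ge {E : Type*} [NormedAddCommGroup E] [InnerProductSpace ℝ E]
    {T : E →L[ℝ] E} (hT : T.toLinearMap.IsSymmetric) :
    ∃ u : E, ‖u‖ ≤ 1 ∧ ∀ v ∈ Metric.ball u (1 / 8), ‖T‖ / 2 ≤ |inner ℝ v (T v)| := by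
  rcases (norm_nonneg T).eq_or_lt with h0 | h0
  · refine ⟨0, by simp, fun v _ => ?_⟩
    rw [← h0, zero_div]
    exact abs_nonneg _
  -- The norm is the supremum of Rayleigh quotients. Moving by `1 / 8` from a near-maximiser costs
  -- at most `1 / 8 * 17 / 8 = 17 / 64` of it, and `49 / 64 - 17 / 64 = 1 / 2`.
  have hlt : 49 / 64 * ‖T‖ < ⨆ x, |T.rayleighQuotient x| := by
    rw [← ContinuousLinearMap.norm_eq_iSup_rayleighQuotient T hT]; linarith
  obtain ⟨x, hx⟩ := exists_lt_of_lt_ciSup hlt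
  have hx0 : x ≠ 0 := by
    rintro rfl
    rw [ContinuousLinearMap.rayleighQuotient_apply_zero, abs_zero] at hx
    linarith
  have hxn : 0 < ‖x‖ := norm_pos_iff.2 hx0
  set u := ‖x‖⁻¹ • x with hu
  have hun : ‖u‖ = 1 := by
    rw [hu, norm_smul, norm_inv, norm_norm, inv_mul_cancel₀ hxn.ne']
  have hq : T.rayleighQuotient x = inner ℝ u (T u) := by
    simp only [ContinuousLinearMap.rayleighQuotient, ContinuousLinearMap.reApplyInnerSelf, hu,
      map_smul, real_inner_smul_left, real_inner_smul_right, RCLike.re_to_real]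
    rw [real_inner_comm]
    field_simp
  refine ⟨u, hun.le, fun v hv => ?_⟩
  rw [mem_ball_iff_norm] at hv
  rw [hq] at hx
  have hdiff : inner ℝ v (T v) - inner ℝ u (T u) = inner ℝ (v - u) (T (v + u)) := by
    have hs : inner ℝ v (T u) = inner ℝ u (T v) := by
      rw [← real_inner_comm]
      exact hT u v
    rw [map_add, inner_add_right, inner_sub_left, inner_sub_left, hs]
    ring
  have hbound : |inner ℝ (v - u) (T (v + u))| ≤ 17 / 64 * ‖T‖ := by
    have h1 : ‖v + u‖ ≤ 17 / 8 := by
      have : v + u = (v - u) + (2 : ℝ) • u := by rw [two_smul]; abel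
      rw [this]
      refine (norm_add_le _ _).trans ?_
      rw [norm_smul, hun]
      norm_num
      linarith
    calc |inner ℝ (v - u) (T (v + u))| ≤ ‖v - u‖ * ‖T (v + u)‖ := abs_real_inner_le_norm _ _
      _ ≤ 1 / 8 * (‖T‖ * (17 / 8)) := by
          gcongr
          exact T.le_of_opNorm_le_of_le le_rfl h1
      _ = 17 / 64 * ‖T‖ := by ring
  have h2 := abs_sub_abs_le_abs_sub (inner ℝ u (T u)) (inner ℝ v (T v))
  rw [abs_sub_comm, hdiff] at h2
  linarith

section Wigner

variable {p : ℕ}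

/-- The pair of indices of the upper-triangular entry at which a symmetric matrix stores a given
entry. -/
def upperIdx (ij : Fin p × Fin p) : {ij : Fin p × Fin p // ij.1 ≤ ij.2} :=
  ⟨(min ij.1 ij.2, max ij.1 ij.2), min_le_max⟩

/-- The coefficients of the quadratic form of a symmetric matrix as a linear form in the
upper-triangular entries. -/
noncomputable def quadCoeff (v : EuclideanSpace ℝ (Fin p)) : NoiseIdx p → ℝ :=
  Sum.elim 0 fun u => ∑ ij with upperIdx ij = u, v ij.1 * v ij.2

lemma inner_symMatrix (v : EuclideanSpace ℝ (Fin p)) (z : NoiseIdx p → ℝ) :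
    inner ℝ v (Matrix.toEuclideanCLM (𝕜 := ℝ) (symMatrix (z ∘ Sum.inr)) v) =
      ∑ s, quadCoeff v s * z s := by
  rw [Matrix.inner_toEuclideanCLM, Fintype.sum_sum_type]
  simp only [quadCoeff, Sum.elim_inl, Sum.elim_inr, Pi.zero_apply, zero_mul,
    Finset.sum_const_zero, zero_add, dotProduct, Matrix.mulVec, Finset.mul_sum]
  rw [← Fintype.sum_prod_type (f := fun ij : Fin p × Fin p =>
    v ij.1 * (symMatrix (z ∘ Sum.inr) ij.1 ij.2 * v ij.2)),
    ← Finset.sum_fiberwise Finset.univ upperIdx]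
  refine Finset.sum_congr rfl fun u _ => ?_
  rw [Finset.sum_mul]
  refine Finset.sum_congr rfl fun ij hij => ?_
  rw [← (Finset.mem_filter.1 hij).2]
  simp only [symMatrix, upperIdx, Matrix.of_apply, Function.comp_apply]
  ring

lemma card_upperIdx_fiber_le (u : {ij : Fin p × Fin p // ij.1 ≤ ij.2}) :
    (Finset.univ.filter fun ij : Fin p × Fin p => upperIdx ij = u).card ≤ 2 := by
  refine (Finset.card_le_card (t := {u.1, u.1.swap}) fun ij hij => ?_).trans Finset.card_le_two
  have h := (Finset.mem_filter.1 hij).2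
  rw [← h, Finset.mem_insert, Finset.mem_singleton]
  rcases le_total ij.1 ij.2 with h1 | h1
  · left; simp [upperIdx, h1]
  · right; simp [upperIdx, h1]

/-- This is the variance of the Gaussian quadratic form at `v`. The factor 2 comes from
Cauchy–Schwarz on fibres of at most two entries, since an off-diagonal variable occurs twice. -/
lemma sum_quadCoeff_sq_le (v : EuclideanSpace ℝ (Fin p)) :
    ∑ s, quadCoeff v s ^ 2 ≤ 2 * ‖v‖ ^ 4 := by
  rw [Fintype.sum_sum_type]
  simp only [quadCoeff, Sum.elim_inl, Sum.elim_inr, Pi.zero_apply]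
  calc ∑ _i : Fin p, (0 : ℝ) ^ 2 + ∑ u, (∑ ij with upperIdx ij = u, v ij.1 * v ij.2) ^ 2
      ≤ 0 + ∑ u, 2 * ∑ ij with upperIdx ij = u, (v ij.1 * v ij.2) ^ 2 := by
        refine add_le_add (by simp) (Finset.sum_le_sum fun u _ => ?_)
        refine sq_sum_le_card_mul_sum_sq.trans ?_
        have : ((Finset.univ.filter fun ij : Fin p × Fin p => upperIdx ij = u).card : ℝ) ≤ 2 := by
          exact_mod_cast card_upperIdx_fiber_le u
        gcongr
    _ = 2 * ‖v‖ ^ 4 := by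
        rw [zero_add, ← Finset.mul_sum, Finset.sum_fiberwise, Fintype.sum_prod_type]
        have h1 : ‖v‖ ^ 4 = (∑ i, v i ^ 2) * ∑ i, v i ^ 2 := by
          have := EuclideanSpace.norm_sq_eq v
          simp only [norm_eq_abs, sq_abs] at this
          rw [← this]; ring
        rw [h1, Finset.sum_mul_sum]
        simp only [mul_pow]

lemma lintegral_exp_gaussPi {ι : Type*} [Fintype ι] (c : ι → ℝ) (l : ℝ) :
    ∫⁻ z, ENNReal.ofReal (exp (l * ∑ i, c i * z i)) ∂gaussPi ι =
      ENNReal.ofReal (exp (l ^ 2 * (∑ i, c i ^ 2) / 2)) := by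
  have h1 := lintegral_map (μ := gaussPi ι) (f := fun y : ℝ => ENNReal.ofReal (exp (l * y)))
    (g := fun z => ∑ i, c i * z i) (by fun_prop) (by fun_prop)
  rw [← h1, gaussPi_map_linear, ← ofReal_integral_eq_lintegral_ofReal
    (integrable_exp_mul_gaussianReal l) (Filter.Eventually.of_forall fun _ => (exp_pos _).le)]
  have h2 := congrFun (mgf_id_gaussianReal (μ := 0) (v := ∑ i, ‖c i‖₊ ^ 2)) l
  simp only [mgf, id] at h2
  rw [h2]
  congr 2
  push_cast
  simp only [norm_eq_abs, sq_abs]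
  ring

lemma isSymmetric_symMatrix (w : {ij : Fin p × Fin p // ij.1 ≤ ij.2} → ℝ) :
    (Matrix.toEuclideanCLM (𝕜 := ℝ) (symMatrix w)).toLinearMap.IsSymmetric := by
  rw [← ContinuousLinearMap.isSelfAdjoint_iff_isSymmetric]
  have h : IsSelfAdjoint (symMatrix w) := by
    rw [isSelfAdjoint_iff, Matrix.star_eq_conjTranspose, Matrix.conjTranspose_eq_transpose_of_trivial]
    exact isSymm_symMatrix w
  exact h.map _

/-- The exponential moments of the operator norm of a symmetric Gaussian matrix. -/
lemma lintegral_exp_norm_symMatrix_le {l : ℝ} (hl : 0 ≤ l) :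
    ∫⁻ z, ENNReal.ofReal (exp (l * (‖Matrix.toEuclideanCLM (𝕜 := ℝ)
        (symMatrix (z ∘ Sum.inr))‖ / 2))) ∂gaussPi (NoiseIdx p) ≤
      ENNReal.ofReal (2 * 16 ^ p * exp (16 * l ^ 2)) := by
  set E := EuclideanSpace ℝ (Fin p)
  set T : (NoiseIdx p → ℝ) → (E →L[ℝ] E) := fun z =>
    Matrix.toEuclideanCLM (𝕜 := ℝ) (symMatrix (z ∘ Sum.inr)) with hTdef
  have hTc : Continuous T := continuous_toEuclideanCLM_symMatrix
  set F : (NoiseIdx p → ℝ) → E → ℝ≥0∞ := fun z v =>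
    ENNReal.ofReal (exp (l * inner ℝ v (T z v))) + ENNReal.ofReal (exp (-l * inner ℝ v (T z v)))
    with hF
  have hcont : Continuous fun q : (NoiseIdx p → ℝ) × E => inner ℝ q.2 (T q.1 q.2) := by fun_prop
  have hFm : Measurable (Function.uncurry F) := by
    have h1 : Measurable fun q : (NoiseIdx p → ℝ) × E =>
        ENNReal.ofReal (exp (l * inner ℝ q.2 (T q.1 q.2))) := by
      exact ENNReal.measurable_ofReal.comp
        (Real.measurable_exp.comp (hcont.measurable.const_mul l))
    have h2 : Measurable fun q : (NoiseIdx p → ℝ) × E =>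
        ENNReal.ofReal (exp (-l * inner ℝ q.2 (T q.1 q.2))) := by
      exact ENNReal.measurable_ofReal.comp
        (Real.measurable_exp.comp (hcont.measurable.const_mul (-l)))
    exact h1.add h2
  set V : ℝ≥0∞ := volume (Metric.ball (0 : E) 1) with hV
  have hVpos : V ≠ 0 := (Metric.measure_ball_pos _ _ one_pos).ne'
  have hVfin : V ≠ ∞ := measure_ball_lt_top.ne
  have hball : ∀ (u : E) {s : ℝ}, 0 < s →
      volume (Metric.ball u s) = ENNReal.ofReal (s ^ p) * V := by
    intro u s hs
    rw [Measure.addHaar_ball_of_pos _ _ hs, finrank_euclideanSpace_fin]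
  -- For each matrix, a ball of radius `1 / 8` inside the ball of radius `2` sees at least half the
  -- norm, so the integral over the larger ball controls the exponential of the norm. The sum of two
  -- exponentials in `F` covers both signs of the form.
  have hlow : ∀ z, ENNReal.ofReal ((1 / 8) ^ p) * V * ENNReal.ofReal (exp (l * (‖T z‖ / 2))) ≤
      ∫⁻ v in Metric.ball 0 2, F z v := by
    intro z
    obtain ⟨u, hu, hT⟩ := exists_ball_quadratic_ge (isSymmetric_symMatrix (z ∘ Sum.inr))
    have hsub : Metric.ball u (1 / 8) ⊆ Metric.ball 0 2 :=
      Metric.ball_subset_ball' (by rw [dist_zero_right]; linarith)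
    rw [← hball u (by norm_num), mul_comm, ← setLIntegral_const]
    refine (setLIntegral_mono (hFm.comp measurable_prodMk_left) fun v hv => ?_).trans
      (lintegral_mono_set hsub)
    have h1 : ‖T z‖ / 2 ≤ |inner ℝ v (T z v)| := hT v hv
    rcases abs_cases (inner ℝ v (T z v)) with ⟨h2, -⟩ | ⟨h2, -⟩
    · refine le_add_right (ENNReal.ofReal_le_ofReal (exp_le_exp.2 ?_))
      rw [← h2]; gcongr
    · refine le_add_left (ENNReal.ofReal_le_ofReal (exp_le_exp.2 ?_))
      rw [neg_mul_comm, ← h2]; gcongr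
  -- After Tonelli, `v` is fixed and the form is Gaussian of variance at most `2 * 2 ^ 4 = 32`,
  -- whence `exp (16 * l ^ 2)`. The volume ratio of the two balls later supplies `16 ^ p`.
  have hup : ∫⁻ z, (∫⁻ v in Metric.ball 0 2, F z v) ∂gaussPi (NoiseIdx p) ≤
      ENNReal.ofReal (2 * exp (16 * l ^ 2)) * (ENNReal.ofReal (2 ^ p) * V) := by
    rw [lintegral_lintegral_swap hFm.aemeasurable, ← hball 0 two_pos, ← setLIntegral_const]
    refine setLIntegral_mono measurable_const fun v hv => ?_
    have hv2 : ‖v‖ ^ 4 ≤ 2 ^ 4 := by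
      rw [mem_ball_zero_iff] at hv; gcongr
    have hc := sum_quadCoeff_sq_le v
    have hexp : ∀ l : ℝ, ∫⁻ z, ENNReal.ofReal (exp (l * inner ℝ v (T z v)))
        ∂gaussPi (NoiseIdx p) ≤ ENNReal.ofReal (exp (16 * l ^ 2)) := by
      intro l
      have hin : ∀ z, inner ℝ v (T z v) = ∑ s, quadCoeff v s * z s := inner_symMatrix v
      simp only [hin]
      rw [lintegral_exp_gaussPi]
      refine ENNReal.ofReal_le_ofReal (exp_le_exp.2 ?_)
      nlinarith [sq_nonneg l]
    simp only [hF]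
    rw [lintegral_add_left]
    · refine (add_le_add (hexp l) (hexp (-l))).trans ?_
      rw [neg_sq, ← ENNReal.ofReal_add (exp_pos _).le (exp_pos _).le, two_mul]
    · have : Continuous fun z => inner ℝ v (T z v) := by fun_prop
      exact ENNReal.measurable_ofReal.comp
        (Real.measurable_exp.comp (this.measurable.const_mul l))
  have hTm : Measurable fun z => ENNReal.ofReal (exp (l * (‖T z‖ / 2))) := by
    have : Continuous fun z => l * (‖T z‖ / 2) := by fun_prop
    exact ENNReal.measurable_ofReal.comp (Real.measurable_exp.comp this.measurable)
  have h := (lintegral_mono hlow).trans hup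
  rw [lintegral_const_mul _ hTm] at h
  set c₈ : ℝ≥0∞ := ENNReal.ofReal ((1 / 8) ^ p) with hc₈
  have hc0 : c₈ * V ≠ 0 := mul_ne_zero (by simp [hc₈]) hVpos
  have hct : c₈ * V ≠ ∞ := ENNReal.mul_ne_top ENNReal.ofReal_ne_top hVfin
  have hrhs : ENNReal.ofReal (2 * exp (16 * l ^ 2)) * (ENNReal.ofReal (2 ^ p) * V) =
      c₈ * V * ENNReal.ofReal (2 * 16 ^ p * exp (16 * l ^ 2)) := by
    have : (2 : ℝ) * exp (16 * l ^ 2) * 2 ^ p = (1 / 8) ^ p * (2 * 16 ^ p * exp (16 * l ^ 2)) := by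
      have : (2 : ℝ) ^ p = (1 / 8) ^ p * 16 ^ p := by rw [← mul_pow]; norm_num
      rw [this]; ring
    rw [← mul_assoc, ← ENNReal.ofReal_mul (by positivity), this,
      ENNReal.ofReal_mul (by positivity), ← hc₈]
    ring
  rw [hrhs] at h
  exact (ENNReal.mul_le_mul_iff_right hc0 hct).1 h

/-- The tail of the operator norm of a symmetric Gaussian matrix. -/
lemma measure_norm_symMatrix_ge_le {s : ℝ} (hs : 0 ≤ s) :
    (gaussPi (NoiseIdx p)).real {z | s ≤ ‖Matrix.toEuclideanCLM (𝕜 := ℝ)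
        (symMatrix (z ∘ Sum.inr))‖} ≤ 2 * 16 ^ p * exp (-(s ^ 2 / 256)) := by
  set T : (NoiseIdx p → ℝ) → (EuclideanSpace ℝ (Fin p) →L[ℝ] EuclideanSpace ℝ (Fin p)) := fun z =>
    Matrix.toEuclideanCLM (𝕜 := ℝ) (symMatrix (z ∘ Sum.inr)) with hTdef
  have hTc : Continuous T := continuous_toEuclideanCLM_symMatrix
  -- The minimiser of the Chernoff exponent `16 * l ^ 2 - l * s / 2`.
  set l := s / 64 with hl
  have hTm : Measurable fun z => ENNReal.ofReal (exp (l * (‖T z‖ / 2))) := by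
    have : Continuous fun z => l * (‖T z‖ / 2) := by fun_prop
    exact ENNReal.measurable_ofReal.comp (Real.measurable_exp.comp this.measurable)
  have h1 := meas_ge_le_lintegral_div (μ := gaussPi (NoiseIdx p)) hTm.aemeasurable
    (ε := ENNReal.ofReal (exp (l * (s / 2)))) (by simp [exp_pos]) ENNReal.ofReal_ne_top
  have h2 : {z | s ≤ ‖T z‖} ⊆ {z | ENNReal.ofReal (exp (l * (s / 2))) ≤
      ENNReal.ofReal (exp (l * (‖T z‖ / 2)))} := by
    intro z hz
    have hz : s ≤ ‖T z‖ := hz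
    refine ENNReal.ofReal_le_ofReal (exp_le_exp.2 ?_)
    have : 0 ≤ l := by positivity
    gcongr
  have h3 := (measure_mono h2).trans (h1.trans (ENNReal.div_le_div_right
    (lintegral_exp_norm_symMatrix_le (p := p) (l := l) (by positivity)) _))
  rw [← ENNReal.ofReal_div_of_pos (exp_pos _)] at h3
  refine (ENNReal.toReal_le_of_le_ofReal (by positivity) h3).trans (le_of_eq ?_)
  rw [mul_div_assoc, ← exp_sub]
  congr 2
  rw [hl]; ring

end Wigner

/-- The two-sided tail of a coordinate of a standard Gaussian vector. -/
lemma measure_abs_ge_le {ι : Type*} [Fintype ι] (i : ι) {t : ℝ} (ht : 0 ≤ t) :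
    (gaussPi ι).real {z | t ≤ |z i|} ≤ 2 * exp (-(t ^ 2 / 2)) := by
  have hlaw : HasLaw (fun z : ι → ℝ => z i) (gaussianReal 0 1) (gaussPi ι) :=
    (measurePreserving_eval (fun _ : ι => gaussianReal 0 1) i).hasLaw
  have h1 : (gaussPi ι).real {z | t ≤ |z i|} = (gaussianReal 0 1).real {y | t ≤ |y|} :=
    hlaw.measureReal_eq (p := fun y => t ≤ |y|) (measurableSet_le measurable_const (by fun_prop))
  rw [h1]
  have hpos : (gaussianReal 0 1).real {y | t ≤ y} ≤ exp (-(t ^ 2 / 2)) := by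
    refine (measure_ge_le_exp_mul_mgf (X := fun y : ℝ => y) t ht
      (integrable_exp_mul_gaussianReal t)).trans (le_of_eq ?_)
    rw [mgf_fun_id_gaussianReal, ← exp_add]
    congr 1
    simp only [NNReal.coe_one]
    ring
  have hneg : (gaussianReal 0 1).real {y | t ≤ -y} ≤ exp (-(t ^ 2 / 2)) := by
    have h2 : HasLaw (fun y : ℝ => -y) (gaussianReal 0 1) (gaussianReal 0 1) :=
      ⟨by fun_prop, by rw [gaussianReal_map_neg, neg_zero]⟩
    rw [h2.measureReal_eq (p := fun y => t ≤ y) (measurableSet_le measurable_const measurable_id)]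
    exact hpos
  have hsub : {y : ℝ | t ≤ |y|} ⊆ {y | t ≤ y} ∪ {y | t ≤ -y} := fun y hy => by
    rcases le_abs.1 (show t ≤ |y| from hy) with h | h
    · exact Or.inl h
    · exact Or.inr h
  refine (measureReal_mono hsub).trans ((measureReal_union_le _ _).trans ?_)
  linarith

/-- One block of noise is small with high probability. -/
lemma measure_noise_large_le {p : ℕ} {t s : ℝ} (ht : 0 ≤ t) (hs : 0 ≤ s) :
    (gaussPi (NoiseIdx p)).real {z | ¬ (‖(WithLp.toLp 2 (z ∘ Sum.inl) :
        EuclideanSpace ℝ (Fin p))‖ ≤ √p * t ∧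
        ‖Matrix.toEuclideanCLM (𝕜 := ℝ) (symMatrix (z ∘ Sum.inr))‖ ≤ s)} ≤
      2 * p * exp (-(t ^ 2 / 2)) + 2 * 16 ^ p * exp (-(s ^ 2 / 256)) := by
  have hsub : {z : NoiseIdx p → ℝ | ¬ (‖(WithLp.toLp 2 (z ∘ Sum.inl) :
        EuclideanSpace ℝ (Fin p))‖ ≤ √p * t ∧
        ‖Matrix.toEuclideanCLM (𝕜 := ℝ) (symMatrix (z ∘ Sum.inr))‖ ≤ s)} ⊆
      (⋃ i : Fin p, {z : NoiseIdx p → ℝ | t ≤ |z (Sum.inl i)|}) ∪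
        {z | s ≤ ‖Matrix.toEuclideanCLM (𝕜 := ℝ) (symMatrix (z ∘ Sum.inr))‖} := by
    intro z hz
    by_contra hcon
    rw [Set.mem_union, not_or, Set.mem_iUnion, not_exists] at hcon
    obtain ⟨h1, h2⟩ := hcon
    refine hz ⟨?_, (not_le.1 h2).le⟩
    rw [EuclideanSpace.norm_eq]
    have h3 : ∑ i, ‖(WithLp.toLp 2 (z ∘ Sum.inl) : EuclideanSpace ℝ (Fin p)) i‖ ^ 2 ≤
        p * t ^ 2 := by
      calc _ ≤ ∑ _i : Fin p, t ^ 2 := Finset.sum_le_sum fun i _ => by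
            have : |z (Sum.inl i)| < t := not_le.1 (h1 i)
            simp only [Function.comp_apply, norm_eq_abs]
            gcongr
        _ = p * t ^ 2 := by simp
    refine (sqrt_le_sqrt h3).trans (le_of_eq ?_)
    rw [sqrt_mul (Nat.cast_nonneg p), sqrt_sq ht]
  refine (measureReal_mono hsub).trans ((measureReal_union_le _ _).trans
    (add_le_add ?_ (measure_norm_symMatrix_ge_le hs)))
  refine (measureReal_iUnion_fintype_le _).trans ?_
  calc _ ≤ ∑ _i : Fin p, 2 * exp (-(t ^ 2 / 2)) :=
        Finset.sum_le_sum fun i _ => measure_abs_ge_le (Sum.inl i) ht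
    _ = _ := by simp; ring

/-- With high probability, all noise vectors and noise matrices are of the expected size. -/
lemma measure_exists_noise_large_le {Ω : Type*} [MeasurableSpace Ω] {P : Measure Ω} {p K : ℕ}
    {Z : ℕ → Ω → EuclideanSpace ℝ (Fin p)} {W : ℕ → Ω → Matrix (Fin p) (Fin p) ℝ}
    (hN : IsNewtonNoise P K Z W) (hp : 0 < p) (hK : 2 ≤ K) {ξ : ℝ} (hξ0 : 0 < ξ)
    (hξ1 : ξ < 1) :
    P.real {ω | ¬ ∀ k < K, ‖Z k ω‖ ≤ 43 * √(p * log (K * p / ξ)) ∧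
      ‖Matrix.toEuclideanCLM (𝕜 := ℝ) (W k ω)‖ ≤ 43 * √(p * log (K * p / ξ))} ≤ ξ := by
  have hp1 : (1 : ℝ) ≤ p := Nat.one_le_cast.2 hp
  have hK2 : (2 : ℝ) ≤ K := by exact_mod_cast hK
  have hN' := hN.indep.isProbabilityMeasure
  set l := log (K * p / ξ) with hl
  have hKp : 2 ≤ (K : ℝ) * p := by nlinarith
  have hratio : 2 ≤ K * p / ξ := by rw [le_div_iff₀ hξ0]; nlinarith
  have hexp : exp (-l) = ξ / (K * p) := by
    rw [exp_neg, hl, exp_log (by linarith), inv_div]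
  have hhalf : exp (-l) ≤ 1 / 2 := by
    rw [hexp, div_le_iff₀ (by linarith)]; nlinarith
  have hl0 : 0 < l := log_pos (by linarith)
  set t := 3 * √l with ht
  -- `43 ^ 2 / 256 > 7`, so the exponent is at least `4 * p * l + 3 * l`. With `exp (-l) ≤ 1 / 2`,
  -- the first part absorbs `16 ^ p`, and the second pays for the union over iterations.
  set s := 43 * √(p * l) with hs
  have ht2 : t ^ 2 = 9 * l := by rw [ht, mul_pow, sq_sqrt hl0.le]; norm_num
  have hs2 : s ^ 2 = 1849 * (p * l) := by
    rw [hs, mul_pow, sq_sqrt (by positivity)]; norm_num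
  have hts : √p * t ≤ s := by
    rw [ht, hs, sqrt_mul (Nat.cast_nonneg p)]
    nlinarith [mul_nonneg (sqrt_nonneg (p : ℝ)) (sqrt_nonneg l)]
  have hblock : ∀ k : Fin K, P.real {ω | ¬ (‖Z k ω‖ ≤ s ∧
      ‖Matrix.toEuclideanCLM (𝕜 := ℝ) (W k ω)‖ ≤ s)} ≤
        2 * p * exp (-(t ^ 2 / 2)) + 2 * 16 ^ p * exp (-(s ^ 2 / 256)) := by
    intro k
    refine le_trans ?_ (measure_noise_large_le (p := p) (t := t) (s := s)
      (by positivity) (by positivity))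
    have hlaw := hN.hasLaw_noiseBlock k.2
    have hm1 : Measurable fun z : NoiseIdx p → ℝ =>
        ‖(WithLp.toLp 2 (z ∘ Sum.inl) : EuclideanSpace ℝ (Fin p))‖ := by
      have : Continuous fun z : NoiseIdx p → ℝ => (WithLp.toLp 2 (z ∘ Sum.inl) :
          EuclideanSpace ℝ (Fin p)) := (PiLp.continuous_toLp 2 _).comp (by fun_prop)
      exact this.norm.measurable
    have hm2 : Measurable fun z : NoiseIdx p → ℝ =>
        ‖Matrix.toEuclideanCLM (𝕜 := ℝ) (symMatrix (z ∘ Sum.inr))‖ :=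
      continuous_toEuclideanCLM_symMatrix.norm.measurable
    have hmeas : MeasurableSet {z : NoiseIdx p → ℝ | ¬ (‖(WithLp.toLp 2 (z ∘ Sum.inl) :
        EuclideanSpace ℝ (Fin p))‖ ≤ √p * t ∧
        ‖Matrix.toEuclideanCLM (𝕜 := ℝ) (symMatrix (z ∘ Sum.inr))‖ ≤ s)} :=
      ((measurableSet_le hm1 measurable_const).inter (measurableSet_le hm2 measurable_const)).compl
    rw [← hlaw.measureReal_eq hmeas]
    refine measureReal_mono fun ω hω => ?_
    intro hcon
    refine hω ⟨hcon.1.trans hts, ?_⟩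
    have h1 : symMatrix (noiseBlock Z W k ω ∘ Sum.inr) = W k ω :=
      symMatrix_of_isSymm (hN.symm k k.2 ω)
    rw [← h1]
    exact hcon.2
  have hsub : {ω | ¬ ∀ k < K, ‖Z k ω‖ ≤ s ∧ ‖Matrix.toEuclideanCLM (𝕜 := ℝ) (W k ω)‖ ≤ s} ⊆
      ⋃ k : Fin K, {ω | ¬ (‖Z k ω‖ ≤ s ∧ ‖Matrix.toEuclideanCLM (𝕜 := ℝ) (W k ω)‖ ≤ s)} := by
    intro ω hω
    by_contra hcon
    rw [Set.mem_iUnion, not_exists] at hcon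
    exact hω fun k hk => not_not.1 (hcon ⟨k, hk⟩)
  refine (measureReal_mono hsub).trans ((measureReal_iUnion_fintype_le _).trans
    ((Finset.sum_le_sum fun k _ => hblock k).trans ?_))
  rw [Finset.sum_const, Finset.card_univ, Fintype.card_fin, nsmul_eq_mul, ht2, hs2]
  set q := exp (-l) with hq
  have hq0 : 0 < q := exp_pos _
  have hqKp : K * p * q = ξ := by rw [hexp]; field_simp
  have e1 : exp (-(9 * l / 2)) ≤ q ^ 4 := by
    rw [hq, ← exp_nat_mul, exp_le_exp]
    push_cast
    linarith
  have e2 : exp (-(1849 * (p * l) / 256)) ≤ (q ^ 4) ^ p * q ^ 3 := by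
    rw [hq, ← exp_nat_mul, ← exp_nat_mul, ← exp_nat_mul, ← exp_add, exp_le_exp]
    push_cast
    nlinarith [mul_le_mul_of_nonneg_right hp1 hl0.le]
  have e3 : (16 : ℝ) ^ p * (q ^ 4) ^ p ≤ 1 := by
    rw [← mul_pow]
    refine pow_le_one₀ (by positivity) ?_
    have : q ^ 4 ≤ (1 / 2) ^ 4 := by gcongr
    linarith
  have e4 : q ^ 2 ≤ 1 / 4 := by
    have : q ^ 2 ≤ (1 / 2) ^ 2 := by gcongr
    linarith
  have hq3 : q ^ 3 ≤ q / 4 := by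
    have : q ^ 3 = q ^ 2 * q := by ring
    rw [this]; nlinarith
  have hq4 : q ^ 4 ≤ q / 4 := by
    have : q ^ 4 = q ^ 3 * q := by ring
    rw [this]; nlinarith
  have f1 : 2 * p * exp (-(9 * l / 2)) ≤ p * q / 2 := by nlinarith
  have f2 : 2 * 16 ^ p * exp (-(1849 * (p * l) / 256)) ≤ q / 2 := by
    calc 2 * 16 ^ p * exp (-(1849 * (p * l) / 256))
        ≤ 2 * 16 ^ p * ((q ^ 4) ^ p * q ^ 3) := by gcongr
      _ = 2 * (16 ^ p * (q ^ 4) ^ p) * q ^ 3 := by ring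
      _ ≤ 2 * 1 * (q / 4) := by gcongr
      _ = q / 2 := by ring
  have f3 : q / 2 ≤ p * q / 2 := by nlinarith
  calc (K : ℝ) * (2 * p * exp (-(9 * l / 2)) + 2 * 16 ^ p * exp (-(1849 * (p * l) / 256)))
      ≤ K * (p * q / 2 + p * q / 2) := by gcongr; exact f2.trans f3
    _ = ξ := by rw [← hqKp]; ring

/-! ### Accuracy -/

section Accuracy

variable {𝓧 : Type*} {p n : ℕ} {ρ : 𝓧 → EuclideanSpace ℝ (Fin p) → ℝ}

/-- Convexity on the whole space makes the gradient monotone along rays leaving the ball, so a small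
gradient at `θinit` already places that point near `θhat`. -/
lemma GramHessian.inner_nonneg {Bbar : ℝ} (hG : GramHessian n ρ Bbar) (x : Fin n → 𝓧)
    (θ v : EuclideanSpace ℝ (Fin p)) : 0 ≤ inner ℝ v (hessian (empRisk ρ x) θ v) := by
  obtain ⟨a, -, ha⟩ := hG
  rw [ha, _root_.smul_apply, _root_.sum_apply, real_inner_smul_right, inner_sum]
  refine mul_nonneg (by positivity) (Finset.sum_nonneg fun i _ => ?_)
  rw [InnerProductSpace.rankOne_apply, real_inner_smul_right, real_inner_comm]
  exact mul_self_nonneg _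

/-- The sum of the convexity inequality and its copy with the points exchanged, hence the factor 2.
-/
lemma LocallyStronglyConvexSmooth.inner_ge {f : EuclideanSpace ℝ (Fin p) → ℝ}
    {θ₀ : EuclideanSpace ℝ (Fin p)} {r τ₁ τ₂ : ℝ} (h : LocallyStronglyConvexSmooth f θ₀ r τ₁ τ₂) :
    ∀ θ₁ ∈ Metric.closedBall θ₀ r, ∀ θ₂ ∈ Metric.closedBall θ₀ r,
      2 * τ₁ * ‖θ₁ - θ₂‖ ^ 2 ≤ inner ℝ (θ₁ - θ₂) (gradient f θ₁ - gradient f θ₂) := by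
  intro θ₁ h₁ θ₂ h₂
  have a := h.1 θ₁ h₁ θ₂ h₂
  have b := h.1 θ₂ h₂ θ₁ h₁
  rw [norm_sub_rev θ₂ θ₁, ← neg_sub θ₁ θ₂, inner_neg_right] at b
  rw [inner_sub_right, real_inner_comm _ (θ₁ - θ₂), real_inner_comm _ (θ₁ - θ₂)]
  linarith

/-- The error of the last noisy Newton iterate when the noise of all iterations is small. -/
lemma norm_noisyNewton_sub_le {Ω : Type*} {L τ₁ τ₂ r B Bbar μ : ℝ} {K : ℕ} (hL : 0 < L)
    (hτ₁ : 0 < τ₁) (hr : 0 < r) (hd : ∀ x, Differentiable ℝ (ρ x))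
    (hd2 : ∀ x, Differentiable ℝ (score ρ x)) (hG : GramHessian n ρ Bbar) {x : Fin n → 𝓧}
    {θ₀ θhat θinit : EuclideanSpace ℝ (Fin p)}
    (hmin : ∀ θ, empRisk ρ x θhat ≤ empRisk ρ x θ)
    (hconv : LocallyStronglyConvexSmooth (empRisk ρ x) θ₀ r τ₁ τ₂)
    (hLip : LipschitzHessian (empRisk ρ x) L) (hhat : θhat ∈ Metric.closedBall θ₀ (r / 2))
    (hinit : ‖gradient (empRisk ρ x) θinit‖ ≤ min (τ₁ * r) (τ₁ ^ 2 / L))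
    {Z : ℕ → Ω → EuclideanSpace ℝ (Fin p)} {W : ℕ → Ω → Matrix (Fin p) (Fin p) ℝ} {ω : Ω}
    {εH εg : ℝ} (hεH0 : 0 ≤ εH) (hεg0 : 0 ≤ εg) (hεH : εH ≤ τ₁ / 2)
    (hεg : εg ≤ τ₁ / 2 * min (r / 2) (τ₁ / (2 * L)))
    (hb : 4 * L / (9 * τ₁ ^ 2) * (εH * (τ₁ / (2 * L)) + εg) ≤ 1 / 48)
    (hW : ∀ k < K, ‖(2 * Bbar * √(2 * K) / (μ * n)) •
      Matrix.toEuclideanCLM (𝕜 := ℝ) (W k ω)‖ ≤ εH)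
    (hZ : ∀ k < K, ‖(2 * B * √(2 * K) / (μ * n)) • Z k ω‖ ≤ εg) :
    ‖noisyNewton ρ 1 B Bbar μ K θinit Z W x K ω - θhat‖ ≤ 3 * τ₁ / (2 * L) *
      (4 * (4 * L / (9 * τ₁ ^ 2) * (εH * (τ₁ / (2 * L)) + εg)) + (1 / 3) ^ 2 ^ K) := by
  set g := gradient (empRisk ρ x) with hgdef
  set H := hessian (empRisk ρ x) with hHdef
  have hg : ∀ θ, HasFDerivAt g (H θ) θ := fun θ =>
    (differentiable_gradient_empRisk hd hd2 x θ).hasFDerivAt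
  have hHc : Continuous H := by
    refine (LipschitzWith.of_dist_le_mul (K := ⟨L, hL.le⟩) fun a b => ?_).continuous
    rw [dist_eq_norm, dist_eq_norm]
    exact hLip a b
  have hg0 : g θhat = 0 := by
    have : IsLocalMin (empRisk ρ x) θhat := Filter.Eventually.of_forall hmin
    rw [hgdef, gradient, this.fderiv_eq_zero, map_zero]
  have hsub : Metric.closedBall θhat (r / 2) ⊆ Metric.closedBall θ₀ r :=
    Metric.closedBall_subset_closedBall' (by rw [Metric.mem_closedBall] at hhat; linarith)
  have hco : ∀ θ ∈ Metric.closedBall θhat (r / 2), ∀ v,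
      2 * τ₁ * ‖v‖ ^ 2 ≤ inner ℝ v (H θ v) := fun θ hθ v =>
    coercive_of_strongMono hg hHc hr hconv.inner_ge (hsub hθ) v
  have he0 : ‖θinit - θhat‖ ≤ r / 2 :=
    norm_sub_le_of_norm_le hg (hG.inner_nonneg x) hg0 (by positivity) (by positivity) hco
      ((hinit.trans (min_le_left _ _)).trans (by linarith))
  -- Now that `θinit` is known to lie in the ball, strong monotonicity bounds its error by the
  -- gradient norm over `2 * τ₁`.
  have he1 : ‖θinit - θhat‖ ≤ τ₁ / (2 * L) := by
    have h1 := hconv.inner_ge θinit (hsub (by rwa [mem_closedBall_iff_norm])) θhat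
      (hsub (Metric.mem_closedBall_self (by positivity)))
    rw [← hgdef, hg0, sub_zero] at h1
    have h2 := real_inner_le_norm (θinit - θhat) (g θinit)
    have h3 := hinit.trans (min_le_right _ _)
    rcases (norm_nonneg (θinit - θhat)).eq_or_lt with h0 | h0
    · rw [← h0]; positivity
    · have h4 : ‖θinit - θhat‖ * (2 * τ₁ * ‖θinit - θhat‖) ≤
          ‖θinit - θhat‖ * (τ₁ ^ 2 / L) := by
        have := mul_le_mul_of_nonneg_left h3 h0.le
        nlinarith
      have h5 := le_of_mul_le_mul_left h4 h0
      rw [le_div_iff₀ hL] at h5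
      rw [le_div_iff₀ (by positivity)]
      have h6 : τ₁ * (‖θinit - θhat‖ * (2 * L)) ≤ τ₁ * τ₁ := by nlinarith
      exact le_of_mul_le_mul_left h6 hτ₁
  refine newton_recursion
    (e := fun k => ‖noisyNewton ρ 1 B Bbar μ K θinit Z W x k ω - θhat‖) hL hτ₁
    (fun _ => norm_nonneg _) he0 he1 hεH0 hεg0 hεH hεg hb fun k hk hek => ?_
  simp only [noisyNewton, one_smul]
  set θ := noisyNewton ρ 1 B Bbar μ K θinit Z W x k ω
  have e1 : noisyHessian ρ Bbar μ K x θ (W k ω) = H θ +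
      (2 * Bbar * √(2 * K) / (μ * n)) • Matrix.toEuclideanCLM (𝕜 := ℝ) (W k ω) := by
    rw [noisyHessian, hHdef, hessian_empRisk hd hd2]
  have e2 : noisyGradient ρ B μ K x θ (Z k ω) = g θ +
      (2 * B * √(2 * K) / (μ * n)) • Z k ω := by
    rw [noisyGradient, hgdef, gradient_empRisk hd]
  rw [e1, e2]
  exact norm_newton_step_sub_le hL.le hτ₁ hg hLip hg0
    (hco θ (by rwa [mem_closedBall_iff_norm])) (hW k hk) (hZ k hk) hεH

end Accuracy

/-- Doubly exponential convergence in doubly logarithmic time. -/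
lemma pow_two_pow_le {μmax y K : ℝ} {k : ℕ} (hk : (k : ℝ) = K) (hμ : 0 < μmax) (hy : 0 < y)
    (hK : 2 * (1 + |log μmax|) * max 1 (log (log y)) ≤ K) :
    ((1 : ℝ) / 3) ^ 2 ^ k ≤ 1 / (μmax * y) := by
  set a := |log μmax| with ha
  set M := max 1 (log (log y)) with hM
  have ha0 : 0 ≤ a := abs_nonneg _
  have hM1 : 1 ≤ M := le_max_left _ _
  have hlogy : log y ≤ exp M := by
    -- For `log y ≤ 0` the iterated logarithm is a default value without meaning, and the bound is
    -- trivial.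
    rcases le_or_gt (log y) 0 with h | h
    · exact h.trans (exp_pos _).le
    · rw [← log_le_iff_le_exp h]; exact le_max_right _ _
  -- The factor 2 in the hypothesis on `K` compensates for `log 2 > 1 / 2`.
  have h2 : exp ((1 + a) * M) ≤ 2 ^ k := by
    have : (2 : ℝ) ^ k = exp (log 2 * k) := by
      rw [mul_comm, exp_nat_mul, exp_log two_pos]
    rw [this, exp_le_exp, hk]
    have := log_two_gt_d9
    nlinarith [mul_nonneg (add_nonneg zero_le_one ha0) (zero_le_one.trans hM1)]
  have h3 : exp M + a ≤ exp ((1 + a) * M) := by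
    have e1 : exp ((1 + a) * M) = exp M * exp (a * M) := by rw [← exp_add]; ring_nf
    have e2 := add_one_le_exp (a * M)
    have e3 := add_one_le_exp M
    have e4 : a ≤ a * M := by nlinarith
    rw [e1]
    nlinarith [exp_pos M]
  have h4 : log (μmax * y) ≤ 2 ^ k := by
    rw [log_mul hμ.ne' hy.ne']
    have := le_abs_self (log μmax)
    linarith
  have h5 : μmax * y ≤ exp 1 ^ 2 ^ k := by
    rw [← exp_nat_mul, mul_one, ← log_le_iff_le_exp (by positivity)]
    exact_mod_cast h4
  have h6 : exp 1 ^ 2 ^ k ≤ (3 : ℝ) ^ 2 ^ k := by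
    gcongr
    linarith [exp_one_lt_d9]
  rw [div_pow, one_pow]
  exact one_div_le_one_div_of_le (by positivity) (h5.trans h6)

/-- The accuracy of the noisy Newton iterate, in terms of the rate `D` of the noise. -/
lemma one_sub_le_measure_norm_noisyNewton_sub_le {𝓧 Ω : Type*} [MeasurableSpace Ω] {P : Measure Ω}
    [IsProbabilityMeasure P] {p n K : ℕ} {ρ : 𝓧 → EuclideanSpace ℝ (Fin p) → ℝ}
    {L τ₁ τ₂ r B Bbar μ ξ D β : ℝ} (hL : 0 < L) (hτ₁ : 0 < τ₁) (hr : 0 < r) (hB : 0 < B)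
    (hBbar : 0 < Bbar) (hμ : 0 < μ) (hn : 0 < n) (hp : 0 < p) (hK : 2 ≤ K) (hξ0 : 0 < ξ)
    (hξ1 : ξ < 1) (hd : ∀ x, Differentiable ℝ (ρ x)) (hd2 : ∀ x, Differentiable ℝ (score ρ x))
    (hG : GramHessian n ρ Bbar) {Z : ℕ → Ω → EuclideanSpace ℝ (Fin p)}
    {W : ℕ → Ω → Matrix (Fin p) (Fin p) ℝ} (hN : IsNewtonNoise P K Z W) {x : Fin n → 𝓧}
    {θ₀ θhat θinit : EuclideanSpace ℝ (Fin p)}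
    (hmin : ∀ θ, empRisk ρ x θhat ≤ empRisk ρ x θ)
    (hconv : LocallyStronglyConvexSmooth (empRisk ρ x) θ₀ r τ₁ τ₂)
    (hLip : LipschitzHessian (empRisk ρ x) L) (hhat : θhat ∈ Metric.closedBall θ₀ (r / 2))
    (hinit : ‖gradient (empRisk ρ x) θinit‖ ≤ min (τ₁ * r) (τ₁ ^ 2 / L))
    (hD : D = √(K * p * log (K * p / ξ)) / (μ * n))
    (hDH : 2 * Bbar * √2 * 43 * D ≤ τ₁ / 2)
    (hDg : 2 * B * √2 * 43 * D ≤ τ₁ / 2 * min (r / 2) (τ₁ / (2 * L)))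
    (hβ : β = 4 * L / (9 * τ₁ ^ 2) * (2 * Bbar * √2 * 43 * (τ₁ / (2 * L)) + 2 * B * √2 * 43))
    (hDβ : β * D ≤ 1 / 48) (hpow : ((1 : ℝ) / 3) ^ 2 ^ K ≤ D) :
    1 - ξ ≤ P.real {ω | ‖noisyNewton ρ 1 B Bbar μ K θinit Z W x K ω - θhat‖ ≤
      3 * τ₁ / (2 * L) * (4 * β + 1) * D} := by
  have hn0 : (0 : ℝ) < n := Nat.cast_pos.2 hn
  have hD0 : 0 ≤ D := by rw [hD]; positivity
  have hnoise := measure_exists_noise_large_le hN hp hK hξ0 hξ1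
  have hscale : ∀ b : ℝ, 2 * b * √(2 * K) / (μ * n) * (43 * √(p * log (K * p / ξ))) =
      2 * b * √2 * 43 * D := by
    intro b
    rw [hD, sqrt_mul two_pos.le, mul_assoc (K : ℝ), sqrt_mul (Nat.cast_nonneg K)]
    ring
  have hgood : ∀ ω, (∀ k < K, ‖Z k ω‖ ≤ 43 * √(p * log (K * p / ξ)) ∧
      ‖Matrix.toEuclideanCLM (𝕜 := ℝ) (W k ω)‖ ≤ 43 * √(p * log (K * p / ξ))) →
      ‖noisyNewton ρ 1 B Bbar μ K θinit Z W x K ω - θhat‖ ≤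
        3 * τ₁ / (2 * L) * (4 * β + 1) * D := by
    intro ω hω
    have hb : 4 * L / (9 * τ₁ ^ 2) * (2 * Bbar * √2 * 43 * D * (τ₁ / (2 * L)) +
        2 * B * √2 * 43 * D) = β * D := by
      rw [hβ]; ring
    have key := norm_noisyNewton_sub_le (θinit := θinit) (Z := Z) (W := W) (ω := ω)
      (B := B) (μ := μ) (K := K) (εH := 2 * Bbar * √2 * 43 * D) (εg := 2 * B * √2 * 43 * D)
      hL hτ₁ hr hd hd2 hG hmin hconv hLip hhat hinit (by positivity) (by positivity)
      hDH hDg (by rw [hb]; exact hDβ)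
      (fun k hk => by
        rw [norm_smul, norm_of_nonneg (by positivity), ← hscale]
        exact mul_le_mul_of_nonneg_left (hω k hk).2 (by positivity))
      (fun k hk => by
        rw [norm_smul, norm_of_nonneg (by positivity), ← hscale]
        exact mul_le_mul_of_nonneg_left (hω k hk).1 (by positivity))
    rw [hb] at key
    refine key.trans ?_
    rw [mul_assoc]
    refine mul_le_mul_of_nonneg_left ?_ (by positivity)
    linarith
  set S := {ω | ‖noisyNewton ρ 1 B Bbar μ K θinit Z W x K ω - θhat‖ ≤
    3 * τ₁ / (2 * L) * (4 * β + 1) * D}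
  have hcompl : P.real Sᶜ ≤ ξ := by
    refine le_trans (measureReal_mono ?_) hnoise
    exact fun ω hω hcon => hω (hgood ω hcon)
  -- Subadditivity suffices, so measurability of `S` is not needed.
  have htot : 1 ≤ P.real S + P.real Sᶜ := by
    have := measureReal_union_le (μ := P) S Sᶜ
    rwa [Set.union_compl_self, probReal_univ] at this
  linarith

end NoisyNewton

theorem theorem3p2 (L τ₁ B Bbar : ℝ) (hL : 0 < L) (hτ₁ : 0 < τ₁) (hB : 0 < B) (hBbar : 0 < Bbar) :
    -- `C` depends on `L`, `τ₁`, `B`, `Bbar`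
    ∃ C : ℝ, 0 < C ∧
    -- the constant in the sample size condition depends in addition on `r`, `τ₂`
    ∀ r τ₂ : ℝ, 0 < r → 0 < τ₂ → ∃ c₁ : ℝ, 0 < c₁ ∧
    -- the constant in the iteration condition depends in addition on an upper bound for `μ`
    ∀ μmax : ℝ, 0 < μmax → ∃ c₂ : ℝ, 0 < c₂ ∧
    ∀ (p n K : ℕ), 0 < p → 0 < n → 0 < K →
    ∀ μ : ℝ, 0 < μ →
    ∀ (𝓧 : Type*) (ρ : 𝓧 → EuclideanSpace ℝ (Fin p) → ℝ),
      -- the loss is twice differentiable in `θ`, with scores bounded by `B`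
      (∀ x, Differentiable ℝ (ρ x)) → (∀ x, Differentiable ℝ (NoisyNewton.score ρ x)) →
      (∀ x θ, ‖NoisyNewton.score ρ x θ‖ ≤ B) →
      NoisyNewton.GramHessian n ρ Bbar →
    ∀ (Ω : Type*) [MeasurableSpace Ω] (P : MeasureTheory.Measure Ω)
      [MeasureTheory.IsProbabilityMeasure P]
      (Z : ℕ → Ω → EuclideanSpace ℝ (Fin p)) (W : ℕ → Ω → Matrix (Fin p) (Fin p) ℝ),
      NoisyNewton.IsNewtonNoise P K Z W →
    ∀ θinit : EuclideanSpace ℝ (Fin p),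
      -- (i) privacy
      NoisyNewton.IsGDP μ P
        (fun x : Fin n → 𝓧 => NoisyNewton.noisyNewton ρ 1 B Bbar μ K θinit Z W x K) ∧
      -- (ii) accuracy
      ∀ (x : Fin n → 𝓧) (θ₀ θhat : EuclideanSpace ℝ (Fin p)) (ξ : ℝ), 0 < ξ → ξ < 1 →
        (∀ θ, NoisyNewton.empRisk ρ x θhat ≤ NoisyNewton.empRisk ρ x θ) →
        NoisyNewton.LocallyStronglyConvexSmooth (NoisyNewton.empRisk ρ x) θ₀ r τ₁ τ₂ →
        NoisyNewton.HessianPosDefOnBall (NoisyNewton.empRisk ρ x) θ₀ r →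
        NoisyNewton.LipschitzHessian (NoisyNewton.empRisk ρ x) L →
        θhat ∈ Metric.closedBall θ₀ (r / 2) →
        ‖gradient (NoisyNewton.empRisk ρ x) θinit‖ ≤ min (τ₁ * r) (τ₁ ^ 2 / L) →
        μ ≤ μmax →
        c₁ * (√(K * p * Real.log (K * p / ξ)) / μ) ≤ (n : ℝ) →
        c₂ * max 1 (Real.log (Real.log n)) ≤ (K : ℝ) →
        1 - ξ ≤ P.real {ω | ‖NoisyNewton.noisyNewton ρ 1 B Bbar μ K θinit Z W x K ω - θhat‖ ≤
          C * (√(K * p * Real.log (K * p / ξ)) / (μ * n))} := by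
  have hs2 : 0 < √(2 : ℝ) := Real.sqrt_pos.2 two_pos
  obtain ⟨AH, hAH⟩ : ∃ a, a = 2 * Bbar * √2 * 43 := ⟨_, rfl⟩
  obtain ⟨Ag, hAg⟩ : ∃ a, a = 2 * B * √2 * 43 := ⟨_, rfl⟩
  have hAH0 : 0 < AH := by rw [hAH]; positivity
  have hAg0 : 0 < Ag := by rw [hAg]; positivity
  obtain ⟨β, hβ⟩ : ∃ b, b = 4 * L / (9 * τ₁ ^ 2) * (AH * (τ₁ / (2 * L)) + Ag) := ⟨_, rfl⟩
  have hβ0 : 0 < β := by rw [hβ]; positivity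
  refine ⟨3 * τ₁ / (2 * L) * (4 * β + 1), by positivity, fun r τ₂ hr hτ₂ => ?_⟩
  obtain ⟨R, hR⟩ : ∃ R, R = min (r / 2) (τ₁ / (2 * L)) := ⟨_, rfl⟩
  have hR0 : 0 < R := by rw [hR]; exact lt_min (by positivity) (by positivity)
  -- The summands enforce, in turn, `AH * D ≤ τ₁ / 2`, `Ag * D ≤ τ₁ / 2 * R` and `β * D ≤ 1 / 48`
  -- for the noise rate `D`.
  refine ⟨2 * AH / τ₁ + 2 * Ag / (τ₁ * R) + 48 * β, by positivity, fun μmax hμmax => ?_⟩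
  -- Being at least 2, this constant also forces `K ≥ 2`, which the noise bound and `hKpl` use.
  refine ⟨2 * (1 + |Real.log μmax|), by positivity, ?_⟩
  intro p n K hp hn hK μ hμ 𝓧 ρ hd hd2 hs hG Ω _ P _ Z W hN θinit
  refine ⟨NoisyNewton.isGDP_noisyNewton hN hn hK hμ hB hBbar hd hd2 hs hG θinit, ?_⟩
  intro x θ₀ θhat ξ hξ0 hξ1 hmin hconv _ hLip hhat hinit hμle hc₁ hc₂
  have hn0 : (0 : ℝ) < n := Nat.cast_pos.2 hn
  have hp1 : (1 : ℝ) ≤ p := Nat.one_le_cast.2 hp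
  have hK2 : (2 : ℝ) ≤ K := by
    have h1 := le_max_left 1 (Real.log (Real.log n))
    have h2 := abs_nonneg (Real.log μmax)
    nlinarith
  obtain ⟨D, hD⟩ : ∃ D, D = √(K * p * Real.log (K * p / ξ)) / (μ * n) := ⟨_, rfl⟩
  have hKp : (2 : ℝ) ≤ K * p := by nlinarith
  have hKpl : 1 ≤ √(K * p * Real.log (K * p / ξ)) := by
    have h1 : Real.log 2 ≤ Real.log (K * p / ξ) := by
      refine Real.log_le_log two_pos ?_
      rw [le_div_iff₀ hξ0]
      nlinarith
    rw [Real.one_le_sqrt]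
    nlinarith [Real.log_two_gt_d9]
  have hD0 : 0 < D := by rw [hD]; positivity
  have hc₁D : (2 * AH / τ₁ + 2 * Ag / (τ₁ * R) + 48 * β) * D ≤ 1 := by
    have h1 : D = √(K * p * Real.log (K * p / ξ)) / μ / n := by rw [hD, div_div]
    rw [h1, ← mul_div_assoc, div_le_one hn0]
    exact hc₁
  have e1 : 0 ≤ 2 * AH / τ₁ * D := by positivity
  have e2 : 0 ≤ 2 * Ag / (τ₁ * R) * D := by positivity
  have e3 : 0 ≤ 48 * β * D := by positivity
  have hDH : 2 * AH / τ₁ * D ≤ 1 := by linarith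
  have hDg : 2 * Ag / (τ₁ * R) * D ≤ 1 := by linarith
  rw [div_mul_eq_mul_div, div_le_one hτ₁] at hDH
  rw [div_mul_eq_mul_div, div_le_one (by positivity)] at hDg
  -- The optimisation error is at most `1 / (μmax * n)`, which is at most `D` because the square
  -- root in `D` is at least 1 and `μ ≤ μmax`.
  have hpow : ((1 : ℝ) / 3) ^ 2 ^ K ≤ D := by
    refine (NoisyNewton.pow_two_pow_le rfl hμmax hn0 hc₂).trans ?_
    rw [hD]
    exact div_le_div₀ (by positivity) hKpl (by positivity)
      (mul_le_mul_of_nonneg_right hμle hn0.le)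
  rw [← hD]
  exact NoisyNewton.one_sub_le_measure_norm_noisyNewton_sub_le hL hτ₁ hr hB hBbar hμ hn hp
    (by exact_mod_cast hK2) hξ0 hξ1 hd hd2 hG hN hmin hconv hLip hhat hinit hD
    (by rw [← hAH]; linarith) (by rw [← hAg, ← hR]; linarith) (by rw [← hAH, ← hAg]; exact hβ)
    (by linarith) hpow
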